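/- **Setting.** Let $m,u\ge 1$ be integers, $n=m+u$, $\mathcal X\subseteq\mathbb R^{d_0}$, $\mathcal Y\subseteq\mathbb R$, and let $(x_1,y_1),\dots,(x_n,y_n)\in\mathcal X\times\mathcal Y$ be the full sample. Let $\mathbf d=(d_1,\dots,d_u)$ have independent entries, $d_i$ uniform on $\{i,\dots,n\}$. Starting from the array $I=(1,\dots,n)$, for $i=1,\dots,u$ put $Z_{\mathbf d}(i)=I(d_i)$ and then swap $I(i)$ and $I(d_i)$. Then $\mathbf Z_{\mathbf d}=\{Z_{\mathbf d}(1),\dots,Z_{\mathbf d}(u)\}$ (the test indices) is a uniformly random $u$-element subset of $[n]=\{1,\dots,n\}$; its complement $\overline{\mathbf Z_{\mathbf d}}$ is the set of training indices. For $h:[n]\to\mathbb R$ write $$\mathcal U_h=\tfrac1u\sum_{i\in \mathbf Z_{\mathbf d}}h(i),\quad \mathcal L_h=\tfrac1m\sum_{i\in\overline{\mathbf Z_{\mathbf d}}}h(i),\quad L_n(h)=\tfrac1n\sum_{i=1}^n h(i),\quad T_n(h)=\tfrac1n\sum_{i=1}^n h(i)^2 .$$ Let $K$ be a positive definite kernel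 on $\mathcal X\times\mathcal X$ (symmetric, with $\sum_{j,k}\alpha_j\alpha_kK(z_j,z_k)\ge0$ for all finite families), let $\mathcal H_K$ be its reproducing kernel Hilbert space, let $\mu>0$, and let $\mathcal F$ be the set of all $f$ in the closed span of $K(\cdot,x_1),\dots,K(\cdot,x_n)$ in $\mathcal H_K$ with $\|f\|_{\mathcal H_K}\le\mu$. Let $\hat\lambda_1\ge\dots\ge\hat\lambda_n$ be the eigenvalues, with multiplicity, of the normalized Gram matrix $\big(\tfrac1nK(x_i,x_j)\big)_{i,j\le n}$, and for $0\le Q\le n$ set $$r(u,m,Q)=Q\Big(\frac1u+\frac1m\Big)+\sqrt{\frac{\sum_{q=Q+1}^n\hat\lambda_q}{u}}+\sqrt{\frac{\sum_{q=Q+1}^n\hat\lambda_q}{m}} .$$ Let $\ell:\mathbb R\times\mathbb R\to\mathbb R$ be a loss function; for a function $f$ on $\mathcal X$ put $\ell_f(i)=\ell(f(x_i),y_i)$, and write $f(i)=f(x_i)$. Let $\hat f_{\mathbf d,m}\in\mathcal F$ be any minimizer over $f\in\mathcal F$ of the training loss $\mathcal L_{\ell_f}$ and $\hat f_{\mathbf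 d,u}\in\mathcal F$ any minimizer of the test loss $\mathcal U_{\ell_f}$. The excess risk is $\mathcal E(\hat f_{\mathbf d,m})=\mathcal U_{\ell_{\hat f_{\mathbf d,m}}}-\mathcal U_{\ell_{\hat f_{\mathbf d,u}}}$. **Assumptions.** 1. $0\le\ell_f(i)\le L_0$ for all $f\in\mathcal F$ and $i\in[n]$, where $L_0\ge2\sqrt2$. 2. $\ell$ is $L$-Lipschitz in its first argument on the values of the predictors: $|\ell(f(a),t)-\ell(g(b),t)|\le L\,|f(a)-g(b)|$ for all $f,g\in\mathcal F$, $a,b\in\mathcal X$, $t\in\mathcal Y$. 3. $f_n^*\in\mathcal F$ satisfies $L_n(\ell_{f_n^*})=\inf_{f\in\mathcal F}L_n(\ell_f)$. 4. $T_n(f-f_n^*)\le B'\,L_n(\ell_f-\ell_{f_n^*})$ for all $f\in\mathcal F$. **Theorem.** Fix a constant $A>1$. There are positive constants $c_1$, depending only on $A,L_0$, and $c_3,c_5$, depending only on $A,L_0,L,B',\mu$, such that in every setting as above and for every $x>0$, with probability at least $1-e^{-x}$ over $\mathbf d$, both of the following hold. For all $f_1,f_2\in\mathcal F$, with $h=\ell_{f_1}-\ell_{f_2}$,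 $$\mathcal U_h\le\mathcal L_h+\frac{2L^2B'}{A}\Big(L_n(\ell_{f_1}-\ell_{f_n^*})+L_n(\ell_{f_2}-\ell_{f_n^*})\Big)+c_3\min_{0\le Q\le n}r(u,m,Q)+\frac{c_1x}{\min\{m,u\}},$$ and $$\mathcal E(\hat f_{\mathbf d,m})\le c_5\Big(\min_{0\le Q\le n}r(u,m,Q)+\frac{x}{\min\{m,u\}}\Big).$$ -/

import Mathlib

open MeasureTheory ProbabilityTheory

namespace TransductiveKernel

/-! ### Sampling the test set uniformly without replacement -/

/-- The possible values of the random vector `d = (d_1, …, d_u)`. With positions numbered from `0`,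
the `i`-th entry takes its values among the positions `j` with `i ≤ j < m + u`. -/
abbrev Draws (m u : ℕ) : Type :=
  (i : Fin u) → {j : Fin (m + u) // (i : ℕ) ≤ (j : ℕ)}

/-- The law of `d`: the entries are independent, and each is uniform on its range. -/
noncomputable def drawLaw (m u : ℕ) : Measure (Draws m u) :=
  Measure.pi fun _ => uniformOn Set.univ

/-- The array of indices held by the algorithm RANDPERM after `k` rounds. It starts as the
identity, and round `k` swaps the values at the positions `k` and `d k`. -/
def randPermState {m u : ℕ} (d : Draws m u) : ℕ → Equiv.Perm (Fin (m + u))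
  | 0 => 1
  | k + 1 =>
    if h : k < u then
      randPermState d k * Equiv.swap ⟨k, h.trans_le (Nat.le_add_left u m)⟩ (d ⟨k, h⟩).1
    else randPermState d k

/-- The output `Z_d` of RANDPERM: in round `i` the value at position `d i` is returned. -/
def randPerm {m u : ℕ} (d : Draws m u) (i : Fin u) : Fin (m + u) :=
  randPermState d i (d i).1

/-- The indices of the test points. -/
def testSet {m u : ℕ} (d : Draws m u) : Finset (Fin (m + u)) :=
  Finset.univ.image (randPerm d)

/-- The indices of the training points. -/
def trainSet {m u : ℕ} (d : Draws m u) : Finset (Fin (m + u)) :=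
  (testSet d)ᶜ

/-! ### Losses. A function on the full sample is identified with its values `h(1), …, h(n)`. -/

/-- The average `L_n(h)` over the full sample. -/
noncomputable def fullAvg {n : ℕ} (h : Fin n → ℝ) : ℝ :=
  (1 / (n : ℝ)) * ∑ i, h i

/-- The average square `T_n(h)` over the full sample. -/
noncomputable def fullSqAvg {n : ℕ} (h : Fin n → ℝ) : ℝ :=
  (1 / (n : ℝ)) * ∑ i, h i ^ 2

/-- The average over the test points. -/
noncomputable def testAvg {m u : ℕ} (d : Draws m u) (h : Fin (m + u) → ℝ) : ℝ :=
  (1 / (u : ℝ)) * ∑ i ∈ testSet d, h i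

/-- The average over the training points. -/
noncomputable def trainAvg {m u : ℕ} (d : Draws m u) (h : Fin (m + u) → ℝ) : ℝ :=
  (1 / (m : ℝ)) * ∑ i ∈ trainSet d, h i

/-- The values `ℓ_f(i) = ℓ(f(x_i), y_i)` on the sample of the loss of the predictor `f`. -/
def lossOf {X : Type*} {n : ℕ} (ℓ : ℝ → ℝ → ℝ) (x : Fin n → X) (y : Fin n → ℝ)
    (f : X → ℝ) (i : Fin n) : ℝ :=
  ℓ (f (x i)) (y i)

/-- `fhat` minimizes the average test loss over the class `F`. -/
def IsTestMinimizer {X H : Type*} [FunLike H X ℝ] {m u : ℕ} (ℓ : ℝ → ℝ → ℝ)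
    (x : Fin (m + u) → X) (y : Fin (m + u) → ℝ) (F : Set H) (d : Draws m u) (fhat : H) : Prop :=
  fhat ∈ F ∧ ∀ f ∈ F, testAvg d (lossOf ℓ x y fhat) ≤ testAvg d (lossOf ℓ x y f)

/-- `fhat` minimizes the average training loss over the class `F`. -/
def IsTrainMinimizer {X H : Type*} [FunLike H X ℝ] {m u : ℕ} (ℓ : ℝ → ℝ → ℝ)
    (x : Fin (m + u) → X) (y : Fin (m + u) → ℝ) (F : Set H) (d : Draws m u) (fhat : H) : Prop :=
  fhat ∈ F ∧ ∀ f ∈ F, trainAvg d (lossOf ℓ x y fhat) ≤ trainAvg d (lossOf ℓ x y f)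

/-- `fstar` minimizes the average loss on the full sample over the class `F`. -/
def IsFullMinimizer {X H : Type*} [FunLike H X ℝ] {n : ℕ} (ℓ : ℝ → ℝ → ℝ)
    (x : Fin n → X) (y : Fin n → ℝ) (F : Set H) (fstar : H) : Prop :=
  fstar ∈ F ∧ ∀ f ∈ F, fullAvg (lossOf ℓ x y fstar) ≤ fullAvg (lossOf ℓ x y f)

/-- The excess risk of `fm`, where `fu` is the oracle predictor. -/
noncomputable def excessRisk {X H : Type*} [FunLike H X ℝ] {m u : ℕ} (ℓ : ℝ → ℝ → ℝ)
    (x : Fin (m + u) → X) (y : Fin (m + u) → ℝ) (d : Draws m u) (fm fu : H) : ℝ :=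
  testAvg d (lossOf ℓ x y fm) - testAvg d (lossOf ℓ x y fu)

/-! ### Reproducing kernel Hilbert spaces and the Gram matrix -/

section Kernel

variable {X : Type*}

/-- `H` is the reproducing kernel Hilbert space of the real kernel `K` (the kernel of an `RKHS` is
operator-valued, and an operator on `ℝ` is multiplication by its value at `1`). -/
def IsRKHSOf (H : Type*) [NormedAddCommGroup H] [InnerProductSpace ℝ H] [CompleteSpace H]
    [RKHS ℝ H X ℝ] (K : Matrix X X ℝ) : Prop :=
  ∀ a b : X, RKHS.kernel H a b 1 = K a b

/-- The closed span of the functions `K(·, x_i)` in the reproducing kernel Hilbert space `H`. -/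
noncomputable def sampleSpace (H : Type*) [NormedAddCommGroup H] [InnerProductSpace ℝ H]
    [CompleteSpace H] [RKHS ℝ H X ℝ] {n : ℕ} (x : Fin n → X) : Submodule ℝ H :=
  (Submodule.span ℝ (Set.range fun i => RKHS.kerFun H (x i) 1)).topologicalClosure

/-- The elements of norm at most `μ` in the closed span of the functions `K(·, x_i)`. -/
def sampleBall (H : Type*) [NormedAddCommGroup H] [InnerProductSpace ℝ H]
    [CompleteSpace H] [RKHS ℝ H X ℝ] {n : ℕ} (x : Fin n → X) (μ : ℝ) : Set H :=
  {f | ‖f‖ ≤ μ ∧ f ∈ sampleSpace H x}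

/-- The normalized Gram matrix, with entries `K(x_i, x_j) / n`. -/
noncomputable def normGram (K : Matrix X X ℝ) {n : ℕ} (x : Fin n → X) :
    Matrix (Fin n) (Fin n) ℝ :=
  (1 / (n : ℝ)) • K.submatrix x x

theorem isHermitian_normGram {K : Matrix X X ℝ} (hK : K.PosSemidef) {n : ℕ} (x : Fin n → X) :
    (normGram K x).IsHermitian := by
  have h := hK.isHermitian.submatrix x
  unfold normGram Matrix.IsHermitian at *
  rw [Matrix.conjTranspose_smul, h]
  simp

/-- The sum of the eigenvalues of the normalized Gram matrix, listed in nonincreasing order with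
multiplicity, with the first `Q` of them left out. -/
noncomputable def tailSum {K : Matrix X X ℝ} (hK : K.PosSemidef) {n : ℕ} (x : Fin n → X)
    (Q : ℕ) : ℝ :=
  ∑ q : Fin (Fintype.card (Fin n)),
    if Q ≤ (q : ℕ) then (isHermitian_normGram hK x).eigenvalues₀ q else 0

/-- The quantity `r(u, m, Q)`. -/
noncomputable def rate {K : Matrix X X ℝ} (hK : K.PosSemidef) {m u : ℕ} (x : Fin (m + u) → X)
    (Q : ℕ) : ℝ :=
  Q * (1 / (u : ℝ) + 1 / (m : ℝ)) +
    (Real.sqrt (tailSum hK x Q / u) + Real.sqrt (tailSum hK x Q / m))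

/-- The minimum of `r(u, m, Q)` over `0 ≤ Q ≤ n`, where `n = m + u`. -/
noncomputable def minRate {K : Matrix X X ℝ} (hK : K.PosSemidef) {m u : ℕ}
    (x : Fin (m + u) → X) : ℝ :=
  (Finset.range (m + u + 1)).inf' Finset.nonempty_range_add_one fun Q => rate hK x Q

end Kernel

end TransductiveKernel

open TransductiveKernel

/-!
The difference of the test and training averages is, up to a factor at most two, a centred sum over
the smaller of the two sets. This set is a uniformly random subset of the sample
(`expect_testSet_eq`), and Hoeffding's comparison (`expect_perm_indicator_le`) bounds the mean of a
convex function of such a sum by its mean for independent draws.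

Concentration needs no bounded-difference or Talagrand inequality, because the bound carries a
penalty proportional to the mean square. For independent draws, the logarithm of the exponential
moment of a supremum of sums is at most the mean of the supremum of the same sums with their squares
added (`expect_exp_ciSup_sum_le`). One coordinate is a second-order expansion of the exponential,
the variance being bounded by the squared increment of a maximizer; the induction over the coordinates
works since a mean of suprema is a supremum over selections. The penalty absorbs the added squares,
so that only the mean of a penalized process is left. Symmetrization and contraction replace the
losses by the predictors in this process. In the eigenbasis of the Gram matrix, completing the
square against the penalty handles the first `Q` coordinates, and the Cauchy--Schwarz inequality in
the Hilbert space the others (`sum_mul_sub_le`); this gives the rate. Markov's inequality yields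
`one_sub_exp_neg_le_deviationBound`, without a multiplicative constant in front of `exp (-s)`.

The excess risk needs the deviation bound with a penalty small enough for the variance condition to
turn it into a quarter of the risk, while the constant `c₁` has to come from the penalty `2 / A`. If
the rate is at least the inverse of the smaller sample size, a union bound over the two events costs
a `log 2` that the rate absorbs. Otherwise the trace of the normalized Gram matrix is below the rate
(`inv_min_le_minRate_or_tailSum_le`), the penalty is itself of the order of the rate, and the event
for the penalty `2 / A` suffices.
-/

namespace TransductiveKernel

open Finset
open scoped BigOperators

/-! ### Averages and finite suprema -/

theorem le_ciSup_of_finite {ι : Type*} [Finite ι] (h : ι → ℝ) (i : ι) : h i ≤ ⨆ i, h i :=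
  le_ciSup (Set.finite_range h).bddAbove i

theorem ciSup_add_le {ι : Type*} [Finite ι] [Nonempty ι] (f g : ι → ℝ) :
    ⨆ i, (f i + g i) ≤ (⨆ i, f i) + ⨆ i, g i :=
  ciSup_le fun i => add_le_add (le_ciSup_of_finite f i) (le_ciSup_of_finite g i)

theorem ciSup_expect_le {ι β : Type*} [Finite ι] [Nonempty ι] [Fintype β] (h : ι → β → ℝ) :
    ⨆ i, 𝔼 x, h i x ≤ 𝔼 x, ⨆ i, h i x :=
  ciSup_le fun i => expect_le_expect fun x _ => le_ciSup_of_finite (fun i => h i x) i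

/-- An average of suprema is a supremum over selections. -/
theorem expect_ciSup {ι β : Type*} [Finite ι] [Nonempty ι] [Fintype β] (h : ι → β → ℝ) :
    𝔼 x, ⨆ i, h i x = ⨆ s : β → ι, 𝔼 x, h (s x) x := by
  apply le_antisymm
  · have hex : ∀ x, ∃ i, h i x = ⨆ i, h i x := fun x => exists_eq_ciSup_of_finite
    choose s hs using hex
    calc 𝔼 x, ⨆ i, h i x = 𝔼 x, h (s x) x := by simp only [hs]
      _ ≤ _ := le_ciSup_of_finite (fun s : β → ι => 𝔼 x, h (s x) x) s
  · exact ciSup_le fun s => expect_le_expect fun x _ => le_ciSup_of_finite (fun i => h i x) (s x)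

theorem expect_fin_succ {α : Type*} [Fintype α] {v : ℕ} (h : (Fin (v + 1) → α) → ℝ) :
    𝔼 X, h X = 𝔼 X : Fin v → α, 𝔼 x, h (Fin.cons x X) := by
  rw [expect_comm, ← expect_product' univ univ (fun (x : α) (X : Fin v → α) => h (Fin.cons x X)),
    univ_product_univ]
  exact (Fintype.expect_equiv (Fin.consEquiv fun _ => α) _ _ fun p => rfl).symm

theorem expect_apply_coord {α : Type*} [Fintype α] [Nonempty α] {v : ℕ} (h : α → ℝ) (j : Fin v) :
    𝔼 X : Fin v → α, h (X j) = 𝔼 x, h x := by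
  induction v with
  | zero => exact j.elim0
  | succ v ih =>
    rw [expect_fin_succ]
    refine Fin.cases ?_ (fun j => ?_) j
    · simp
    · simp [ih]

theorem sq_expect_le {β : Type*} [Fintype β] [Nonempty β] (h : β → ℝ) :
    (𝔼 x, h x) ^ 2 ≤ 𝔼 x, h x ^ 2 := by
  have h1 : 0 ≤ 𝔼 x, (h x - 𝔼 y, h y) ^ 2 := expect_nonneg fun x _ => sq_nonneg _
  have h2 : 𝔼 x, (h x - 𝔼 y, h y) ^ 2 = 𝔼 x, h x ^ 2 - (𝔼 x, h x) ^ 2 := by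
    simp only [sub_sq, expect_add_distrib, expect_sub_distrib, Fintype.expect_const,
      ← expect_mul, ← mul_expect]
    ring
  linarith

/-! ### Exponential moments of suprema -/

/-- Averaging over a single coordinate. The square of the increment of the supremum is at most the
square of the increment of a maximizer, so that the variance of the supremum is paid for by adding
a multiple of the squares to the process. -/
theorem expect_exp_ciSup_le {ι α : Type*} [Finite ι] [Nonempty ι] [Fintype α] [Nonempty α]
    (a : ι → ℝ) (g q : ι → α → ℝ) {lam b : ℝ} (hlam : 0 ≤ lam) (hb : 2 * lam * b ≤ 1)
    (hg : ∀ i x, |g i x| ≤ b) (hq : ∀ i x, g i x ^ 2 ≤ q i x) :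
    𝔼 x, Real.exp (lam * ⨆ i, (a i + g i x)) ≤
      Real.exp (lam * 𝔼 x, ⨆ i, (a i + (g i x + 2 * lam * (q i x + 𝔼 y, q i y)))) := by
  set W : α → ℝ := fun x => ⨆ i, (a i + g i x) with hW
  have hex : ∀ x, ∃ i, a i + g i x = W x := fun x => exists_eq_ciSup_of_finite
  choose s hs using hex
  have hle : ∀ i x, a i + g i x ≤ W x := fun i x => le_ciSup_of_finite (fun i => a i + g i x) i
  have hinc : ∀ x y, W x - W y ≤ g (s x) x - g (s x) y := fun x y => by
    have := hle (s x) y; have := hs x; linarith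
  set e := 𝔼 x, W x with he
  have hdiff : ∀ x y, |W x - W y| ≤ 2 * b := fun x y => by
    have h1 := hinc x y; have h2 := hinc y x
    have h3 := abs_le.1 (hg (s x) x); have h4 := abs_le.1 (hg (s x) y)
    have h5 := abs_le.1 (hg (s y) x); have h6 := abs_le.1 (hg (s y) y)
    rw [abs_le]; constructor <;> linarith
  have hdev : ∀ x, |lam * (W x - e)| ≤ 1 := fun x => by
    have h1 : W x - e = 𝔼 y, (W x - W y) := by
      rw [expect_sub_distrib, Fintype.expect_const]
    have h2 : |W x - e| ≤ 2 * b := by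
      rw [h1]
      exact (abs_expect_le _ _).trans (expect_le univ_nonempty fun y _ => hdiff x y)
    rw [abs_mul, abs_of_nonneg hlam]
    nlinarith
  have hvar : 𝔼 x, (W x - e) ^ 2 ≤ 2 * 𝔼 x, (q (s x) x + 𝔼 y, q (s x) y) := by
    have h1 : 𝔼 x, 𝔼 y, (W x - W y) ^ 2 = 2 * 𝔼 x, (W x - e) ^ 2 := by
      simp only [sub_sq, expect_add_distrib, expect_sub_distrib, Fintype.expect_const,
        ← expect_mul, ← mul_expect, ← he]
      ring
    have h2 : ∀ x y, (W x - W y) ^ 2 ≤ 2 * (g (s x) x ^ 2 + g (s x) y ^ 2) +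
        2 * (g (s y) y ^ 2 + g (s y) x ^ 2) := fun x y => by
      have h1 := hinc x y; have h2 := hinc y x
      rcases le_total 0 (W x - W y) with h | h
      · nlinarith [sq_nonneg (g (s x) x + g (s x) y), sq_nonneg (g (s y) y),
          sq_nonneg (g (s y) x)]
      · nlinarith [sq_nonneg (g (s y) x + g (s y) y), sq_nonneg (g (s x) y),
          sq_nonneg (g (s x) x)]
    have h3 : 𝔼 x, 𝔼 y, (W x - W y) ^ 2 ≤ 𝔼 x, 𝔼 y, (2 * (q (s x) x + q (s x) y) +
        2 * (q (s y) y + q (s y) x)) :=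
      expect_le_expect fun x _ => expect_le_expect fun y _ => (h2 x y).trans (by
        have := hq (s x) x; have := hq (s x) y; have := hq (s y) x; have := hq (s y) y
        linarith)
    have h4 : 𝔼 x, 𝔼 y, (2 * (q (s x) x + q (s x) y) + 2 * (q (s y) y + q (s y) x)) =
        4 * 𝔼 x, (q (s x) x + 𝔼 y, q (s x) y) := by
      have h5 : 𝔼 x, 𝔼 y, q (s y) x = 𝔼 x, 𝔼 y, q (s x) y := expect_comm _ _ _
      simp only [expect_add_distrib, Fintype.expect_const, ← mul_expect, h5]
      ring
    linarith
  have hexp : 𝔼 x, Real.exp (lam * (W x - e)) ≤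
      Real.exp (lam ^ 2 * 𝔼 x, (W x - e) ^ 2) := by
    calc 𝔼 x, Real.exp (lam * (W x - e))
        ≤ 𝔼 x, (1 + lam * (W x - e) + (lam * (W x - e)) ^ 2) :=
          expect_le_expect fun x _ => by
            have := (abs_le.1 (Real.abs_exp_sub_one_sub_id_le (hdev x))).2
            linarith
      _ = lam ^ 2 * 𝔼 x, (W x - e) ^ 2 + 1 := by
          simp only [mul_pow, expect_add_distrib, Fintype.expect_const, ← mul_expect,
            expect_sub_distrib, ← he]
          ring
      _ ≤ _ := Real.add_one_le_exp _
  have hfin : e + lam * 𝔼 x, (W x - e) ^ 2 ≤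
      𝔼 x, ⨆ i, (a i + (g i x + 2 * lam * (q i x + 𝔼 y, q i y))) := by
    calc e + lam * 𝔼 x, (W x - e) ^ 2
        ≤ e + lam * (2 * 𝔼 x, (q (s x) x + 𝔼 y, q (s x) y)) := by gcongr
      _ = 𝔼 x, (a (s x) + (g (s x) x + 2 * lam * (q (s x) x + 𝔼 y, q (s x) y))) := by
          rw [he, ← mul_assoc, mul_comm lam 2, mul_expect, ← expect_add_distrib]
          refine expect_congr rfl fun x _ => ?_
          rw [← hs x]; ring
      _ ≤ _ := expect_le_expect fun x _ =>
          le_ciSup_of_finite (fun i => a i + (g i x + 2 * lam * (q i x + 𝔼 y, q i y))) (s x)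
  calc 𝔼 x, Real.exp (lam * W x)
      = Real.exp (lam * e) * 𝔼 x, Real.exp (lam * (W x - e)) := by
        rw [mul_expect]
        refine expect_congr rfl fun x _ => ?_
        rw [← Real.exp_add]; ring_nf
    _ ≤ Real.exp (lam * e) * Real.exp (lam ^ 2 * 𝔼 x, (W x - e) ^ 2) := by gcongr
    _ = Real.exp (lam * (e + lam * 𝔼 x, (W x - e) ^ 2)) := by
        rw [← Real.exp_add]; ring_nf
    _ ≤ _ := by gcongr

/-- For an independent sample, the exponential moment of a supremum of sums is bounded by the mean
of the supremum of sums compensated by the squares. By induction on the sample size: once a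
coordinate is averaged out, the suprema over the class become a supremum over selections from it,
and averaging over a selection keeps `g ^ 2 ≤ q`. -/
theorem expect_exp_ciSup_sum_le {α : Type} [Fintype α] [Nonempty α] {lam b : ℝ}
    (hlam : 0 ≤ lam) (hb : 2 * lam * b ≤ 1) (v : ℕ) {ι : Type} [Finite ι] [Nonempty ι]
    (a : ι → ℝ) (g q : ι → α → ℝ)
    (hg : ∀ i x, |g i x| ≤ b) (hq : ∀ i x, g i x ^ 2 ≤ q i x) :
    𝔼 X : Fin v → α, Real.exp (lam * ⨆ i, (a i + ∑ j, g i (X j))) ≤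
      Real.exp (lam * 𝔼 X : Fin v → α,
        ⨆ i, (a i + ∑ j, (g i (X j) + 2 * lam * (q i (X j) + 𝔼 y, q i y)))) := by
  induction v generalizing ι with
  | zero => simp
  | succ v ih =>
    set c : ι → α → ℝ := fun i x => g i x + 2 * lam * (q i x + 𝔼 y, q i y) with hc
    rw [expect_fin_succ, expect_fin_succ]
    simp only [Fin.sum_univ_succ, Fin.cons_zero, Fin.cons_succ]
    have hstep : ∀ X : Fin v → α,
        𝔼 x, Real.exp (lam * ⨆ i, (a i + (g i x + ∑ j, g i (X j)))) ≤
        Real.exp (lam * ⨆ s : α → ι,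
          (𝔼 x, (a (s x) + c (s x) x) + ∑ j, 𝔼 x, g (s x) (X j))) := fun X => by
      have h := expect_exp_ciSup_le (fun i => a i + ∑ j, g i (X j)) g q hlam hb hg hq
      have h2 : 𝔼 x, ⨆ i, (a i + ∑ j, g i (X j) + c i x) = ⨆ s : α → ι,
          (𝔼 x, (a (s x) + c (s x) x) + ∑ j, 𝔼 x, g (s x) (X j)) := by
        rw [expect_ciSup]
        congr! 2 with s
        rw [← expect_sum_comm, ← expect_add_distrib]
        exact expect_congr rfl fun x _ => by ring
      rw [h2] at h
      refine le_of_eq_of_le (expect_congr rfl fun x _ => ?_) h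
      congr! 4
      ring
    refine (expect_le_expect fun X _ => hstep X).trans ?_
    refine (ih (fun s : α → ι => 𝔼 x, (a (s x) + c (s x) x)) (fun s y => 𝔼 x, g (s x) y)
      (fun s y => 𝔼 x, q (s x) y) ?_ ?_).trans (le_of_eq ?_)
    · exact fun s y => (abs_expect_le _ _).trans (expect_le univ_nonempty fun x _ => hg _ _)
    · exact fun s y => (sq_expect_le _).trans (expect_le_expect fun x _ => hq _ _)
    · congr! 3 with X
      rw [expect_ciSup]
      congr! 2 with s
      have h3 : ∀ j, 𝔼 x, g (s x) (X j) + 2 * lam * (𝔼 x, q (s x) (X j) +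
          𝔼 y, 𝔼 x, q (s x) y) = 𝔼 x, c (s x) (X j) := fun j => by
        rw [expect_comm, ← expect_add_distrib, mul_expect, ← expect_add_distrib]
      simp only [h3]
      rw [← expect_sum_comm, ← expect_add_distrib]
      exact expect_congr rfl fun x _ => by simp only [hc]; ring

/-! ### Symmetrization and contraction -/

/-- The sign attached to a Boolean. -/
def boolSign (e : Bool) : ℝ := if e then 1 else -1

theorem expect_bool (h : Bool → ℝ) : 𝔼 e, h e = (h true + h false) / 2 := by
  rw [Fintype.expect_eq_sum_div_card]; simp

theorem expect_sum_boolSign_mul_sq {v : ℕ} (b : Fin v → ℝ) :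
    𝔼 e : Fin v → Bool, (∑ j, boolSign (e j) * b j) ^ 2 = ∑ j, b j ^ 2 := by
  induction v with
  | zero => simp
  | succ v ih =>
    rw [expect_fin_succ]
    simp only [Fin.sum_univ_succ, Fin.cons_zero, Fin.cons_succ, expect_bool]
    rw [← ih, ← Fintype.expect_const (ι := Fin v → Bool) (b 0 ^ 2), ← expect_add_distrib]
    exact expect_congr rfl fun e _ => by simp [boolSign]; ring

/-- The contraction principle for Rademacher averages of a class, with an additive term that may
depend on the member of the class. -/
theorem expect_ciSup_boolSign_contraction {ι : Type*} [Finite ι] [Nonempty ι] {v : ℕ}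
    (a : ι → ℝ) (p t : ι → Fin v → ℝ) (hpt : ∀ i k j, |p i j - p k j| ≤ |t i j - t k j|) :
    𝔼 e : Fin v → Bool, ⨆ i, (a i + ∑ j, boolSign (e j) * p i j) ≤
      𝔼 e : Fin v → Bool, ⨆ i, (a i + ∑ j, boolSign (e j) * t i j) := by
  have hone : ∀ (a : ι → ℝ) (p t : ι → ℝ), (∀ i k, |p i - p k| ≤ |t i - t k|) →
      𝔼 e, ⨆ i, (a i + boolSign e * p i) ≤ 𝔼 e, ⨆ i, (a i + boolSign e * t i) := by
    intro a p t h
    rw [expect_bool, expect_bool]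
    obtain ⟨i, hi⟩ := exists_eq_ciSup_of_finite (f := fun i => a i + boolSign true * p i)
    obtain ⟨k, hk⟩ := exists_eq_ciSup_of_finite (f := fun i => a i + boolSign false * p i)
    rw [← hi, ← hk]
    have h1 := le_ciSup_of_finite (fun i => a i + boolSign true * t i) i
    have h2 := le_ciSup_of_finite (fun i => a i + boolSign true * t i) k
    have h3 := le_ciSup_of_finite (fun i => a i + boolSign false * t i) i
    have h4 := le_ciSup_of_finite (fun i => a i + boolSign false * t i) k
    have h5 := (le_abs_self _).trans (h i k)
    simp only [boolSign, if_true, Bool.false_eq_true, if_false] at *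
    rcases abs_cases (t i - t k) with h6 | h6 <;> linarith [h6.1]
  induction v generalizing a with
  | zero => simp
  | succ v ih =>
    rw [expect_fin_succ, expect_fin_succ]
    simp only [Fin.sum_univ_succ, Fin.cons_zero, Fin.cons_succ]
    calc 𝔼 e : Fin v → Bool, 𝔼 s, ⨆ i, (a i + (boolSign s * p i 0 +
            ∑ j, boolSign (e j) * p i j.succ))
        ≤ 𝔼 e : Fin v → Bool, 𝔼 s, ⨆ i, (a i + (boolSign s * t i 0 +
            ∑ j, boolSign (e j) * p i j.succ)) := by
          refine expect_le_expect fun e _ => ?_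
          have := hone (fun i => a i + ∑ j, boolSign (e j) * p i j.succ) (fun i => p i 0)
            (fun i => t i 0) fun i k => hpt i k 0
          simpa only [add_assoc, add_comm (∑ j, boolSign (e j) * p _ (Fin.succ j))] using this
      _ = 𝔼 s, 𝔼 e : Fin v → Bool, ⨆ i, (a i + boolSign s * t i 0 +
            ∑ j, boolSign (e j) * p i j.succ) := by
          rw [expect_comm]; simp only [add_assoc]
      _ ≤ 𝔼 s, 𝔼 e : Fin v → Bool, ⨆ i, (a i + boolSign s * t i 0 +
            ∑ j, boolSign (e j) * t i j.succ) :=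
          expect_le_expect fun s _ => ih _ _ _ fun i k j => hpt i k j.succ
      _ = _ := by
          rw [expect_comm]; simp only [add_assoc]

/-- Symmetrization of a centred empirical process minus a penalty. -/
theorem expect_ciSup_symmetrization {ι α : Type*} [Finite ι] [Nonempty ι] [Fintype α] [Nonempty α]
    (v : ℕ) (p : ι → α → ℝ) (c : ι → ℝ) :
    𝔼 X : Fin v → α, ⨆ i, (∑ j, (p i (X j) - 𝔼 y, p i y) - 2 * c i) ≤
      2 * 𝔼 X : Fin v → α, 𝔼 e : Fin v → Bool,
        ⨆ i, (-c i + ∑ j, boolSign (e j) * p i (X j)) := by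
  have hghost : 𝔼 X : Fin v → α, ⨆ i, (∑ j, (p i (X j) - 𝔼 y, p i y) - 2 * c i) ≤
      𝔼 X : Fin v → α, 𝔼 X' : Fin v → α, ⨆ i, (∑ j, (p i (X j) - p i (X' j)) - 2 * c i) := by
    refine expect_le_expect fun X _ => ?_
    refine le_of_eq_of_le ?_ (ciSup_expect_le _)
    congr! 2 with i
    rw [expect_sub_distrib, expect_sum_comm, Fintype.expect_const]
    congr! 2 with j
    rw [expect_sub_distrib, expect_apply_coord, Fintype.expect_const]
  have hswap : ∀ e : Fin v → Bool,
      𝔼 X : Fin v → α, 𝔼 X' : Fin v → α, ⨆ i, (∑ j, (p i (X j) - p i (X' j)) - 2 * c i) =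
      𝔼 X : Fin v → α, 𝔼 X' : Fin v → α,
        ⨆ i, (∑ j, boolSign (e j) * (p i (X j) - p i (X' j)) - 2 * c i) := fun e => by
    rw [← expect_product', ← expect_product', univ_product_univ]
    let E : (Fin v → α) × (Fin v → α) ≃ (Fin v → α) × (Fin v → α) :=
      { toFun := fun P => (fun j => if e j then P.1 j else P.2 j,
          fun j => if e j then P.2 j else P.1 j)
        invFun := fun P => (fun j => if e j then P.1 j else P.2 j,
          fun j => if e j then P.2 j else P.1 j)
        left_inv := fun P => by
          ext j <;> by_cases h : e j <;> simp [h]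
        right_inv := fun P => by
          ext j <;> by_cases h : e j <;> simp [h] }
    refine Fintype.expect_equiv E _ _ fun P => ?_
    congr! 4 with i j
    by_cases h : e j <;> simp [E, h, boolSign]
  have hneg : ∀ X' : Fin v → α,
      𝔼 e : Fin v → Bool, ⨆ i, (-c i + ∑ j, boolSign (!(e j)) * p i (X' j)) =
      𝔼 e : Fin v → Bool, ⨆ i, (-c i + ∑ j, boolSign (e j) * p i (X' j)) := fun X' =>
    Fintype.expect_equiv (Equiv.piCongrRight fun _ => Equiv.boolNot) _ _ fun e => rfl
  calc _ ≤ _ := hghost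
    _ = 𝔼 e : Fin v → Bool, 𝔼 X : Fin v → α, 𝔼 X' : Fin v → α,
        ⨆ i, (∑ j, boolSign (e j) * (p i (X j) - p i (X' j)) - 2 * c i) := by
        rw [← Fintype.expect_const (ι := Fin v → Bool)
          (𝔼 X : Fin v → α, 𝔼 X' : Fin v → α, ⨆ i, (∑ j, (p i (X j) - p i (X' j)) - 2 * c i))]
        exact expect_congr rfl fun e _ => hswap e
    _ ≤ 𝔼 e : Fin v → Bool, 𝔼 X : Fin v → α, 𝔼 X' : Fin v → α,
        ((⨆ i, (-c i + ∑ j, boolSign (e j) * p i (X j))) +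
          ⨆ i, (-c i + ∑ j, boolSign (!(e j)) * p i (X' j))) := by
        refine expect_le_expect fun e _ => expect_le_expect fun X _ =>
          expect_le_expect fun X' _ => le_trans (le_of_eq ?_) (ciSup_add_le _ _)
        congr! 2 with i
        have : ∑ j, boolSign (!(e j)) * p i (X' j) = -∑ j, boolSign (e j) * p i (X' j) := by
          rw [← sum_neg_distrib]
          exact sum_congr rfl fun j _ => by cases e j <;> simp [boolSign]
        rw [this]
        simp only [mul_sub, sum_sub_distrib]
        ring
    _ = _ := by
        simp only [expect_add_distrib, Fintype.expect_const]
        rw [expect_comm univ univ (fun (e : Fin v → Bool) (X : Fin v → α) =>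
            ⨆ i, (-c i + ∑ j, boolSign (e j) * p i (X j))),
          expect_comm univ univ (fun (e : Fin v → Bool) (X : Fin v → α) =>
            ⨆ i, (-c i + ∑ j, boolSign (!(e j)) * p i (X j)))]
        simp only [hneg]
        ring

/-! ### Sampling with and without replacement -/

theorem exists_perm_forall_mem {α : Type*} [Fintype α] [DecidableEq α] (S : Finset α)
    (X : Fin #S → α) : ∃ τ : Equiv.Perm α, ∀ j, τ (X j) ∈ S := by
  have hcard : #(univ.image X) ≤ #S := card_image_le.trans (by simp)
  obtain ⟨T, hT, hTS⟩ := exists_superset_card_eq hcard (card_le_univ S)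
  have e : {x // x ∈ T} ≃ {x // x ∈ S} := Fintype.equivOfCardEq (by simp [hTS])
  exact ⟨e.extendSubtype, fun j => e.extendSubtype_mem _ (hT (mem_image_of_mem X (mem_univ j)))⟩

theorem expect_perm_mul_left {α : Type*} [Fintype α] [DecidableEq α] (τ : Equiv.Perm α)
    (G : Equiv.Perm α → ℝ) : 𝔼 ρ, G (τ * ρ) = 𝔼 ρ, G ρ :=
  Fintype.expect_equiv (Equiv.mulLeft τ) _ _ fun _ => rfl

/-- Hoeffding's comparison: the mean of a convex function of the counting vector of a sample drawn
without replacement is at most the mean for a sample of the same size drawn with replacement.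
A sample with replacement can be relabelled to lie inside the set `S`, and averaging its counting
vector over the cyclic shifts of `S` gives the indicator of `S`. -/
theorem expect_perm_indicator_le {α : Type*} [Fintype α] [DecidableEq α] {F : (α → ℝ) → ℝ}
    (hF : ConvexOn ℝ Set.univ F) {S : Finset α} (hS : S.Nonempty) :
    𝔼 ρ : Equiv.Perm α, F (fun a => if ρ a ∈ S then 1 else 0) ≤
      𝔼 X : Fin #S → α, F (fun a => ∑ j, if X j = a then 1 else 0) := by
  have hne : NeZero #S := ⟨hS.card_pos.ne'⟩
  let e : Fin #S ≃ S := S.equivFin.symm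
  let shift : Fin #S → Equiv.Perm α := fun c =>
    Equiv.Perm.ofSubtype (e.permCongr (Equiv.addRight c))
  have havg : ∀ Y : Fin #S → α, (∀ j, Y j ∈ S) → ∀ b,
      (𝔼 c : Fin #S, ∑ j, if Y j = shift c b then (1 : ℝ) else 0) = if b ∈ S then 1 else 0 := by
    intro Y hY b
    split_ifs with hb
    · have hshift : ∀ c, shift c b = e (e.symm ⟨b, hb⟩ + c) := fun c => by
        simp [shift, Equiv.Perm.ofSubtype_apply_of_mem _ hb, Equiv.permCongr_apply]
      have hiff : ∀ c j, Y j = shift c b ↔ c = e.symm ⟨Y j, hY j⟩ - e.symm ⟨b, hb⟩ := fun c j => by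
        rw [hshift, eq_sub_iff_add_eq', Equiv.eq_symm_apply, Subtype.ext_iff, eq_comm]
      rw [expect_sum_comm]
      simp only [hiff]
      simp
    · have hshift : ∀ c, shift c b = b := fun c =>
        Equiv.Perm.ofSubtype_apply_of_not_mem _ hb
      have : ∀ j, Y j ≠ b := fun j h => hb (h ▸ hY j)
      simp [hshift, this]
  have key : ∀ X : Fin #S → α, 𝔼 ρ : Equiv.Perm α, F (fun a => if ρ a ∈ S then 1 else 0) ≤
      𝔼 ρ : Equiv.Perm α, F (fun a => ∑ j, if X j = ρ a then 1 else 0) := by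
    intro X
    obtain ⟨τ, hτ⟩ := exists_perm_forall_mem S X
    calc 𝔼 ρ : Equiv.Perm α, F (fun a => if ρ a ∈ S then 1 else 0)
        = 𝔼 ρ : Equiv.Perm α, F (𝔼 c : Fin #S,
            fun a => ∑ j, if τ (X j) = shift c (ρ a) then 1 else 0) := by
          refine expect_congr rfl fun ρ _ => congrArg F (funext fun a => ?_)
          rw [expect_apply, havg _ hτ]
      _ ≤ 𝔼 ρ : Equiv.Perm α, 𝔼 c : Fin #S,
            F (fun a => ∑ j, if τ (X j) = shift c (ρ a) then 1 else 0) := by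
          refine expect_le_expect fun ρ _ => ?_
          have := hF.map_sum_le (t := univ) (w := fun _ => (#S : ℝ)⁻¹)
            (p := fun c a => ∑ j, if τ (X j) = shift c (ρ a) then 1 else 0)
            (fun _ _ => by positivity)
            (by simp) (fun _ _ => Set.mem_univ _)
          rw [Fintype.expect_eq_sum_div_card]
          convert this using 1
          · congr 1
            funext a
            rw [expect_apply, Fintype.expect_eq_sum_div_card, Finset.sum_apply, div_eq_inv_mul,
              mul_sum]
            simp
          · simp [div_eq_inv_mul, mul_sum]
      _ = 𝔼 c : Fin #S, 𝔼 ρ : Equiv.Perm α,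
            F (fun a => ∑ j, if X j = (τ⁻¹ * shift c * ρ) a then 1 else 0) := by
          rw [expect_comm]
          refine expect_congr rfl fun c _ => expect_congr rfl fun ρ _ => ?_
          simp only [Equiv.Perm.coe_mul, Function.comp_apply, Equiv.Perm.eq_inv_iff_eq]
      _ = _ := by
          simp only [fun c => expect_perm_mul_left (τ⁻¹ * shift c)
            fun ρ => F (fun a => ∑ j, if X j = ρ a then 1 else 0), Fintype.expect_const]
  calc 𝔼 ρ : Equiv.Perm α, F (fun a => if ρ a ∈ S then 1 else 0)
      = 𝔼 X : Fin #S → α, 𝔼 ρ : Equiv.Perm α, F (fun a => if ρ a ∈ S then 1 else 0) := by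
        have : Nonempty α := ⟨hS.choose⟩
        rw [Fintype.expect_const]
    _ ≤ 𝔼 X : Fin #S → α, 𝔼 ρ : Equiv.Perm α, F (fun a => ∑ j, if X j = ρ a then 1 else 0) :=
        expect_le_expect fun X _ => key X
    _ = 𝔼 ρ : Equiv.Perm α, 𝔼 X : Fin #S → α, F (fun a => ∑ j, if X j = a then 1 else 0) := by
        rw [expect_comm]
        refine expect_congr rfl fun ρ _ => ?_
        refine Fintype.expect_equiv (Equiv.arrowCongr (Equiv.refl _) ρ⁻¹) _ _ fun X => ?_
        congr! 4 with a j
        exact (Equiv.symm_apply_eq ρ).symm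
    _ = _ := Fintype.expect_const _

/-! ### The law of the test set -/

section Draws

variable {m u : ℕ}

instance (i : Fin u) : Nonempty {j : Fin (m + u) // (i : ℕ) ≤ (j : ℕ)} :=
  ⟨⟨⟨i, by omega⟩, le_rfl⟩⟩

theorem randPermState_succ (d : Draws m u) (i : Fin u) :
    randPermState d (i + 1) =
      randPermState d i * Equiv.swap (Fin.castLE (Nat.le_add_left u m) i) (d i).1 := by
  simp [randPermState, Fin.castLE]

/-- Later rounds only swap positions after `i`, so the output of round `i` stays at position `i`. -/
theorem randPermState_apply_castLE (d : Draws m u) (i : Fin u) {k : ℕ} (hk : i < k) :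
    randPermState d k (Fin.castLE (Nat.le_add_left u m) i) = randPerm d i := by
  induction k, Nat.succ_le_of_lt hk using Nat.le_induction with
  | base =>
    rw [Nat.succ_eq_add_one, randPermState_succ]
    simp [randPerm]
  | succ k hik ih =>
    by_cases hku : k < u
    · have h := randPermState_succ d ⟨k, hku⟩
      simp only at h
      rw [h, Equiv.Perm.mul_apply, Equiv.swap_apply_of_ne_of_ne, ih (by omega)]
      · intro h'; simp [Fin.ext_iff] at h'; omega
      · intro h'
        have := (d ⟨k, hku⟩).2
        rw [← h'] at this
        simp at this; omega
    · rw [randPermState, dif_neg hku, ih (by omega)]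

theorem randPerm_injective (d : Draws m u) : Function.Injective (randPerm d) := fun i j h => by
  rw [← randPermState_apply_castLE d i i.2, ← randPermState_apply_castLE d j j.2] at h
  exact Fin.castLE_injective _ ((randPermState d u).injective h)

theorem draws_ext_of_randPerm_eq {d d' : Draws m u} (h : randPerm d = randPerm d') : d = d' := by
  have hstate : ∀ k ≤ u, randPermState d k = randPermState d' k ∧
      ∀ i : Fin u, i < k → d i = d' i := by
    intro k hk
    induction k with
    | zero => exact ⟨rfl, fun i hi => absurd hi (Nat.not_lt_zero _)⟩
    | succ k ih =>
      obtain ⟨h1, h2⟩ := ih (by omega)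
      have h3 : d ⟨k, hk⟩ = d' ⟨k, hk⟩ := by
        have := congrFun h ⟨k, hk⟩
        simp only [randPerm, h1] at this
        exact Subtype.ext ((randPermState d' k).injective this)
      refine ⟨?_, fun i hi => ?_⟩
      · have e1 := randPermState_succ d ⟨k, hk⟩
        have e2 := randPermState_succ d' ⟨k, hk⟩
        simp only at e1 e2
        rw [e1, e2, h1, h3]
      · rcases Nat.lt_succ_iff_lt_or_eq.1 hi with hi | hi
        · exact h2 i hi
        · have : i = ⟨k, hk⟩ := Fin.ext hi
          rw [this, h3]
  exact funext fun i => (hstate u le_rfl).2 i i.2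

theorem card_draws : Fintype.card (Draws m u) = Fintype.card (Fin u ↪ Fin (m + u)) := by
  rw [Fintype.card_embedding_eq, Fintype.card_pi, Fintype.card_fin, Fintype.card_fin,
    Nat.descFactorial_eq_prod_range, prod_range]
  refine prod_congr rfl fun i _ => ?_
  have h := Fin.card_Ici (Fin.castLE (Nat.le_add_left u m) i)
  rw [Fintype.card_subtype]
  simp only [Fin.val_castLE] at h
  rw [← h]
  congr 1
  ext j
  simp [Fin.le_def]

/-- Vectors of draws correspond to ordered samples without replacement. -/
noncomputable def drawsEquivEmbedding (m u : ℕ) : Draws m u ≃ (Fin u ↪ Fin (m + u)) :=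
  Equiv.ofBijective (fun d => ⟨randPerm d, randPerm_injective d⟩)
    ((Fintype.bijective_iff_injective_and_card _).2
      ⟨fun _ _ h => draws_ext_of_randPerm_eq (congrArg (fun e : Fin u ↪ Fin (m + u) => ⇑e) h),
        card_draws⟩)

theorem card_testSet (d : Draws m u) : #(testSet d) = u := by
  rw [testSet, card_image_of_injective _ (randPerm_injective d), card_univ, Fintype.card_fin]

theorem mem_trainSet {d : Draws m u} {a : Fin (m + u)} : a ∈ trainSet d ↔ a ∉ testSet d :=
  mem_compl

theorem card_trainSet (d : Draws m u) : #(trainSet d) = m := by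
  rw [trainSet, card_compl, card_testSet, Fintype.card_fin]; omega

theorem expect_testSet_perm (G : Finset (Fin (m + u)) → ℝ) (ρ : Equiv.Perm (Fin (m + u))) :
    𝔼 d : Draws m u, G ((testSet d).image ρ) = 𝔼 d : Draws m u, G (testSet d) := by
  have h : ∀ G : Finset (Fin (m + u)) → ℝ, 𝔼 d : Draws m u, G (testSet d) =
      𝔼 e : Fin u ↪ Fin (m + u), G (univ.image e) := fun G =>
    Fintype.expect_equiv (drawsEquivEmbedding m u) _ _ fun d => rfl
  rw [h, h fun T => G (T.image ρ)]
  refine Fintype.expect_equiv (Equiv.embeddingCongr (Equiv.refl _) ρ) _ _ fun e => ?_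
  rw [image_image]; rfl

/-- The law of the test set is invariant under permutations of the sample. -/
theorem expect_testSet_eq (G : Finset (Fin (m + u)) → ℝ) :
    𝔼 d : Draws m u, G (testSet d) = 𝔼 d : Draws m u, 𝔼 ρ : Equiv.Perm (Fin (m + u)),
      G (univ.filter fun a => ρ a ∈ testSet d) := by
  have h : ∀ (T : Finset (Fin (m + u))) (ρ : Equiv.Perm (Fin (m + u))),
      (univ.filter fun a => ρ a ∈ T) = T.image ⇑ρ⁻¹ := fun T ρ => by
    ext a
    simp [Equiv.symm_apply_eq]
  rw [expect_comm]
  simp only [h, expect_testSet_perm, Fintype.expect_const]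

theorem expect_testSet_le {F : (Fin (m + u) → ℝ) → ℝ} (hF : ConvexOn ℝ Set.univ F) (hu : 0 < u) :
    𝔼 d : Draws m u, F (fun a => if a ∈ testSet d then 1 else 0) ≤
      𝔼 X : Fin u → Fin (m + u), F (fun a => ∑ j, if X j = a then 1 else 0) := by
  rw [expect_testSet_eq fun T => F fun a => if a ∈ T then 1 else 0]
  refine expect_le univ_nonempty fun d _ => ?_
  have hd := card_testSet d
  have := expect_perm_indicator_le hF (S := testSet d) (card_pos.1 (by omega))
  simp only [mem_filter, mem_univ, true_and]
  rwa [hd] at this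

theorem expect_trainSet_le {F : (Fin (m + u) → ℝ) → ℝ} (hF : ConvexOn ℝ Set.univ F) (hm : 0 < m) :
    𝔼 d : Draws m u, F (fun a => if a ∈ trainSet d then 1 else 0) ≤
      𝔼 X : Fin m → Fin (m + u), F (fun a => ∑ j, if X j = a then 1 else 0) := by
  simp only [mem_trainSet, ite_not]
  rw [expect_testSet_eq fun T => F fun a => if a ∈ T then 0 else 1]
  refine expect_le univ_nonempty fun d _ => ?_
  have hd := card_trainSet d
  have := expect_perm_indicator_le hF (S := trainSet d) (card_pos.1 (by omega))
  rw [hd] at this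
  simpa only [mem_trainSet, ite_not, mem_filter, mem_univ, true_and] using this

theorem drawLaw_real_singleton (d : Draws m u) :
    (drawLaw m u).real {d} = (Fintype.card (Draws m u) : ℝ)⁻¹ := by
  rw [measureReal_def, drawLaw, ← Set.univ_pi_singleton, Measure.pi_pi]
  simp [uniformOn_univ, ENNReal.toReal_prod, Fintype.card_pi]

instance : IsProbabilityMeasure (drawLaw m u) := by
  unfold drawLaw
  have : ∀ i : Fin u, IsProbabilityMeasure
      (uniformOn (Set.univ : Set {j : Fin (m + u) // (i : ℕ) ≤ (j : ℕ)})) := fun i =>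
    isProbabilityMeasure_uniformOn Set.finite_univ Set.univ_nonempty
  infer_instance

open Classical in
theorem drawLaw_real_eq (S : Set (Draws m u)) :
    (drawLaw m u).real S = 𝔼 d, if d ∈ S then (1 : ℝ) else 0 := by
  have hS : S = ((univ.filter (· ∈ S) : Finset (Draws m u)) : Set (Draws m u)) := by simp
  rw [Fintype.expect_eq_sum_div_card]
  conv_lhs => rw [hS, ← sum_measureReal_singleton]
  simp [drawLaw_real_singleton, div_eq_mul_inv]

/-- Markov's inequality in exponential form. -/
theorem one_sub_exp_neg_le_drawLaw {Z : Draws m u → ℝ} {r : ℝ}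
    (hZ : 𝔼 d, Real.exp (Z d) ≤ Real.exp r) (s : ℝ) {S : Set (Draws m u)}
    (hS : ∀ d, Z d ≤ r + s → d ∈ S) : 1 - Real.exp (-s) ≤ (drawLaw m u).real S := by
  classical
  rw [drawLaw_real_eq]
  have h1 : 𝔼 d, (1 - Real.exp (Z d - (r + s))) ≤ 𝔼 d, if d ∈ S then (1 : ℝ) else 0 := by
    refine expect_le_expect fun d _ => ?_
    split_ifs with hd
    · linarith [Real.exp_pos (Z d - (r + s))]
    · have := Real.one_le_exp (x := Z d - (r + s)) (by
        by_contra h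
        exact hd (hS d (by linarith)))
      linarith
  refine le_trans ?_ h1
  rw [expect_sub_distrib, Fintype.expect_const]
  have h2 : 𝔼 d, Real.exp (Z d - (r + s)) = Real.exp (-(r + s)) * 𝔼 d, Real.exp (Z d) := by
    rw [mul_expect]
    exact expect_congr rfl fun d _ => by rw [← Real.exp_add]; ring_nf
  have h3 : Real.exp (-(r + s)) * 𝔼 d, Real.exp (Z d) ≤ Real.exp (-(r + s)) * Real.exp r := by
    gcongr
  rw [← Real.exp_add, show -(r + s) + r = -s by ring] at h3
  linarith

end Draws

/-! ### Spectral bounds in the reproducing kernel Hilbert space -/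

section Kernel

variable {X : Type*} {K : Matrix X X ℝ} {n : ℕ} {x : Fin n → X}

/-- The `i`-th coordinate of the `q`-th eigenvector of the normalized Gram matrix. -/
noncomputable def eigvec (hK : K.PosSemidef) (x : Fin n → X) (q i : Fin n) : ℝ :=
  (isHermitian_normGram hK x).eigenvectorBasis q i

/-- The coefficient of a vector along the `q`-th eigenvector of the normalized Gram matrix. -/
noncomputable def eigcoeff (hK : K.PosSemidef) (x : Fin n → X) (q : Fin n) (a : Fin n → ℝ) : ℝ :=
  ∑ i, eigvec hK x q i * a i

theorem sum_mul_eq_sum_eigcoeff (hK : K.PosSemidef) (a b : Fin n → ℝ) :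
    ∑ i, a i * b i = ∑ q, eigcoeff hK x q a * eigcoeff hK x q b := by
  have h := (isHermitian_normGram hK x).eigenvectorBasis.sum_inner_mul_inner
    (WithLp.toLp 2 a) (WithLp.toLp 2 b)
  simp only [PiLp.inner_apply, RCLike.inner_apply, conj_trivial] at h
  calc ∑ i, a i * b i = ∑ i, b i * a i := sum_congr rfl fun i _ => mul_comm _ _
    _ = _ := h.symm
    _ = _ := by
      refine sum_congr rfl fun q _ => ?_
      simp only [eigcoeff, eigvec, mul_comm]

theorem sum_eigvec_mul_eigvec (hK : K.PosSemidef) (q p : Fin n) :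
    ∑ i, eigvec hK x q i * eigvec hK x p i = if q = p then 1 else 0 := by
  have h := orthonormal_iff_ite.1 (isHermitian_normGram hK x).eigenvectorBasis.orthonormal q p
  simp only [PiLp.inner_apply, RCLike.inner_apply, conj_trivial] at h
  rw [← h]
  exact sum_congr rfl fun i _ => mul_comm _ _

theorem sum_kernel_mul_eigvec (hK : K.PosSemidef) (q i : Fin n) :
    ∑ j, K (x i) (x j) * eigvec hK x q j =
      n * (isHermitian_normGram hK x).eigenvalues q * eigvec hK x q i := by
  have h := congrFun ((isHermitian_normGram hK x).mulVec_eigenvectorBasis q) i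
  have hn : (n : ℝ) ≠ 0 := by
    have := i.pos
    positivity
  simp only [Matrix.mulVec, dotProduct, normGram, Matrix.smul_apply, Matrix.submatrix_apply,
    smul_eq_mul, Pi.smul_apply] at h
  rw [mul_assoc]
  refine Eq.trans ?_ (congrArg ((n : ℝ) * ·) h)
  rw [mul_sum]
  refine sum_congr rfl fun j _ => ?_
  simp only [eigvec]
  field_simp
  rfl

theorem eigenvalues_normGram_nonneg (hK : K.PosSemidef) (q : Fin n) :
    0 ≤ (isHermitian_normGram hK x).eigenvalues q := by
  have h : (normGram K x).PosSemidef := (hK.submatrix x).smul (by positivity)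
  exact h.eigenvalues_nonneg q

/-- The indices of the eigenvectors that are left after the first `Q` in the nonincreasing order
of the eigenvalues. -/
noncomputable def tailIndices (n Q : ℕ) : Finset (Fin n) :=
  univ.filter fun q =>
    Q ≤ (((Fintype.equivOfCardEq (Fintype.card_fin _)).symm q : Fin (Fintype.card (Fin n))) : ℕ)

theorem sum_tailIndices (hK : K.PosSemidef) (x : Fin n → X) (Q : ℕ) :
    ∑ q ∈ tailIndices n Q, (isHermitian_normGram hK x).eigenvalues q = tailSum hK x Q := by
  rw [tailSum, tailIndices, sum_filter]
  exact Fintype.sum_equiv (Fintype.equivOfCardEq (Fintype.card_fin _)).symm _ _ fun q => rfl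

theorem card_compl_tailIndices_le (n Q : ℕ) : #(tailIndices n Q)ᶜ ≤ Q := by
  rw [tailIndices, compl_filter]
  calc _ ≤ #(range Q) := card_le_card_of_injOn (fun q =>
        (((Fintype.equivOfCardEq (Fintype.card_fin _)).symm q : Fin (Fintype.card (Fin n))) : ℕ))
        (fun q hq => by simpa using hq)
        (fun q _ p _ h => (Fintype.equivOfCardEq (Fintype.card_fin _)).symm.injective (Fin.ext h))
    _ = Q := card_range Q

theorem tailSum_nonneg (hK : K.PosSemidef) (x : Fin n → X) (Q : ℕ) : 0 ≤ tailSum hK x Q := by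
  rw [← sum_tailIndices]
  exact sum_nonneg fun q _ => eigenvalues_normGram_nonneg hK q

theorem tailSum_zero (hK : K.PosSemidef) (x : Fin n → X) :
    tailSum hK x 0 = (1 / (n : ℝ)) * ∑ i, K (x i) (x i) := by
  have h := (isHermitian_normGram hK x).trace_eq_sum_eigenvalues
  have h2 : tailIndices n 0 = univ := by simp [tailIndices]
  rw [← sum_tailIndices, h2]
  simp only [RCLike.ofReal_real_eq_id, id] at h
  rw [← h, Matrix.trace, mul_sum]
  simp [normGram]

variable {H : Type*} [NormedAddCommGroup H] [InnerProductSpace ℝ H] [CompleteSpace H]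
  [RKHS ℝ H X ℝ]

theorem inner_kerFun_one (w : H) (a : X) : inner ℝ w (RKHS.kerFun H a 1) = w a := by
  rw [RKHS.inner_kerFun]; simp

theorem inner_kerFun_kerFun (hH : IsRKHSOf H K) (a b : X) :
    inner ℝ (RKHS.kerFun H a 1) (RKHS.kerFun H b 1) = K a b := by
  rw [RKHS.kerFun_inner, RKHS.kerFun_apply, hH]; simp

theorem sq_apply_le (hH : IsRKHSOf H K) (w : H) (a : X) : w a ^ 2 ≤ ‖w‖ ^ 2 * K a a := by
  have h := abs_real_inner_le_norm w (RKHS.kerFun H a 1)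
  rw [inner_kerFun_one] at h
  have h2 : ‖RKHS.kerFun H a (1 : ℝ)‖ ^ 2 = K a a := by
    rw [← real_inner_self_eq_norm_sq, inner_kerFun_kerFun hH]
  rw [← h2, ← mul_pow]
  exact sq_le_sq.2 (h.trans (le_abs_self _))

variable (H) in
/-- The member of the Hilbert space that represents the `q`-th eigenvector of the Gram matrix. -/
noncomputable def eigfun (hK : K.PosSemidef) (x : Fin n → X) (q : Fin n) : H :=
  ∑ i, eigvec hK x q i • RKHS.kerFun H (x i) 1

theorem inner_eigfun (hK : K.PosSemidef) (w : H) (q : Fin n) :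
    inner ℝ w (eigfun H hK x q) = eigcoeff hK x q fun i => w (x i) := by
  simp [eigfun, eigcoeff, inner_sum, inner_smul_right]

theorem inner_eigfun_eigfun (hK : K.PosSemidef) (hH : IsRKHSOf H K) (q p : Fin n) :
    inner ℝ (eigfun H hK x q) (eigfun H hK x p) =
      if q = p then n * (isHermitian_normGram hK x).eigenvalues q else 0 := by
  have h1 : ∀ i, (eigfun H hK x q) (x i) =
      n * (isHermitian_normGram hK x).eigenvalues q * eigvec hK x q i := fun i => by
    rw [← sum_kernel_mul_eigvec, ← inner_kerFun_one, eigfun, sum_inner]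
    refine sum_congr rfl fun j _ => ?_
    rw [real_inner_smul_left, inner_kerFun_kerFun hH, mul_comm]
    exact congrArg (· * eigvec hK x q j) (hK.isHermitian.apply (x i) (x j))
  rw [inner_eigfun, eigcoeff]
  simp only [h1, mul_left_comm _ ((n : ℝ) * _) _, ← mul_sum]
  rw [sum_eigvec_mul_eigvec]
  by_cases h : q = p <;> simp [h, eq_comm]

theorem norm_sq_sum_smul_eigfun (hK : K.PosSemidef) (hH : IsRKHSOf H K) (S : Finset (Fin n))
    (b : Fin n → ℝ) : ‖∑ q ∈ S, b q • eigfun H hK x q‖ ^ 2 =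
      ∑ q ∈ S, n * (isHermitian_normGram hK x).eigenvalues q * b q ^ 2 := by
  rw [← real_inner_self_eq_norm_sq, sum_inner]
  refine sum_congr rfl fun q hq => ?_
  rw [inner_sum]
  simp only [real_inner_smul_left, inner_smul_right, inner_eigfun_eigfun hK hH]
  simp [hq]; ring

/-- A linear functional minus a multiple of the empirical square norm, over a ball of the Hilbert
space: the leading coordinates are handled by completing the square, the remaining ones by the
Cauchy--Schwarz inequality in the Hilbert space. -/
theorem sum_mul_sub_le (hK : K.PosSemidef) (hH : IsRKHSOf H K) (S : Finset (Fin n)) {w : H}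
    {M D : ℝ} (hw : ‖w‖ ≤ M) (hD : 0 < D) (N : Fin n → ℝ) :
    ∑ i, N i * w (x i) - D * ∑ i, w (x i) ^ 2 ≤
      (∑ q ∈ Sᶜ, eigcoeff hK x q N ^ 2) / (4 * D) +
        M * √(∑ q ∈ S, n * (isHermitian_normGram hK x).eigenvalues q * eigcoeff hK x q N ^ 2) := by
  set c : Fin n → ℝ := fun q => eigcoeff hK x q fun i => w (x i) with hc
  have h1 : ∑ i, w (x i) ^ 2 = ∑ q, c q ^ 2 := by
    simp only [sq]; exact sum_mul_eq_sum_eigcoeff hK _ _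
  rw [sum_mul_eq_sum_eigcoeff hK, h1, ← sum_add_sum_compl S,
    ← sum_add_sum_compl S (fun q => c q ^ 2)]
  have htail : ∑ q ∈ S, eigcoeff hK x q N * c q ≤
      M * √(∑ q ∈ S, n * (isHermitian_normGram hK x).eigenvalues q * eigcoeff hK x q N ^ 2) := by
    have h2 : ∑ q ∈ S, eigcoeff hK x q N * c q =
        inner ℝ w (∑ q ∈ S, eigcoeff hK x q N • eigfun H hK x q) := by
      simp only [inner_sum, inner_smul_right, inner_eigfun, hc]
    rw [h2, ← norm_sq_sum_smul_eigfun hK hH, Real.sqrt_sq (norm_nonneg _)]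
    exact (real_inner_le_norm _ _).trans (by gcongr)
  have hlead : ∑ q ∈ Sᶜ, eigcoeff hK x q N * c q ≤
      (∑ q ∈ Sᶜ, eigcoeff hK x q N ^ 2) / (4 * D) + D * ∑ q ∈ Sᶜ, c q ^ 2 := by
    rw [sum_div, mul_sum, ← sum_add_distrib]
    refine sum_le_sum fun q _ => ?_
    rw [← sub_nonneg]
    have : eigcoeff hK x q N ^ 2 / (4 * D) + D * c q ^ 2 - eigcoeff hK x q N * c q =
        (eigcoeff hK x q N - 2 * D * c q) ^ 2 / (4 * D) := by
      field_simp; ring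
    rw [this]; positivity
  have : 0 ≤ D * ∑ q ∈ S, c q ^ 2 := by positivity
  generalize (∑ q ∈ Sᶜ, eigcoeff hK x q N ^ 2) / (4 * D) = z at hlead ⊢
  linarith

theorem expect_sqrt_le {β : Type*} [Fintype β] [Nonempty β] {h : β → ℝ} (hh : ∀ x, 0 ≤ h x) :
    𝔼 x, √(h x) ≤ √(𝔼 x, h x) := by
  refine Real.le_sqrt_of_sq_le ((sq_expect_le _).trans (le_of_eq ?_))
  exact expect_congr rfl fun x _ => Real.sq_sqrt (hh x)

/-- The localized Rademacher complexity of a ball of the Hilbert space. -/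
theorem expect_ciSup_boolSign_rkhs_le [NeZero n] (hK : K.PosSemidef) (hH : IsRKHSOf H K)
    {ι : Type*} [Finite ι] [Nonempty ι] (w : ι → H) {M D : ℝ} (hw : ∀ i, ‖w i‖ ≤ M) (hD : 0 < D)
    (v Q : ℕ) :
    𝔼 Y : Fin v → Fin n, 𝔼 e : Fin v → Bool,
      ⨆ i, (-(D * ∑ k, w i (x k) ^ 2) + ∑ j, boolSign (e j) * w i (x (Y j))) ≤
      Q * v / (4 * D * n) + M * √(v * tailSum hK x Q) := by
  have hn : (n : ℝ) ≠ 0 := by exact_mod_cast NeZero.ne n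
  have hM : 0 ≤ M := (norm_nonneg _).trans (hw (Classical.arbitrary ι))
  set S := tailIndices n Q
  set lamb := (isHermitian_normGram hK x).eigenvalues with hlamb
  let N : (Fin v → Fin n) → (Fin v → Bool) → Fin n → ℝ := fun Y e q =>
    ∑ j, boolSign (e j) * eigvec hK x q (Y j)
  let T : (Fin v → Fin n) → (Fin v → Bool) → ℝ := fun Y e =>
    ∑ q ∈ S, n * lamb q * N Y e q ^ 2
  have hT0 : ∀ Y e, 0 ≤ T Y e := fun Y e => sum_nonneg fun q _ => by
    have := eigenvalues_normGram_nonneg (x := x) hK q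
    positivity
  have hNsq : ∀ q, 𝔼 Y, 𝔼 e, N Y e q ^ 2 = v / n := fun q => by
    simp only [N, expect_sum_boolSign_mul_sq]
    rw [expect_sum_comm]
    simp only [expect_apply_coord (fun i => eigvec hK x q i ^ 2)]
    have : 𝔼 i, eigvec hK x q i ^ 2 = 1 / n := by
      have h := sum_eigvec_mul_eigvec (x := x) hK q q
      simp only [← sq, if_true] at h
      rw [Fintype.expect_eq_sum_div_card, h, Fintype.card_fin]
    rw [this]; simp [div_eq_mul_inv]
  have hpt : ∀ Y e, ⨆ i, (-(D * ∑ k, w i (x k) ^ 2) + ∑ j, boolSign (e j) * w i (x (Y j))) ≤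
      (∑ q ∈ Sᶜ, N Y e q ^ 2) / (4 * D) + M * √(T Y e) := fun Y e => by
    refine ciSup_le fun i => ?_
    have h := sum_mul_sub_le (x := x) hK hH S (hw i) hD
      fun k => ∑ j, if Y j = k then boolSign (e j) else 0
    have h1 : ∀ a : Fin n → ℝ, ∑ k, (∑ j, if Y j = k then boolSign (e j) else 0) * a k =
        ∑ j, boolSign (e j) * a (Y j) := fun a => by
      simp only [sum_mul, ite_mul, zero_mul]
      rw [sum_comm]
      simp
    have h2 : ∀ q, eigcoeff hK x q (fun k => ∑ j, if Y j = k then boolSign (e j) else 0) =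
        N Y e q := fun q => by
      simp only [eigcoeff, N, ← h1]
      exact sum_congr rfl fun k _ => mul_comm _ _
    rw [h1 fun k => w i (x k)] at h
    simp only [h2] at h
    rwa [neg_add_eq_sub]
  have hT : 𝔼 Y, 𝔼 e, √(T Y e) ≤ √(v * tailSum hK x Q) := by
    calc 𝔼 Y, 𝔼 e, √(T Y e) ≤ 𝔼 Y, √(𝔼 e, T Y e) :=
          expect_le_expect fun Y _ => expect_sqrt_le (hT0 Y)
      _ ≤ √(𝔼 Y, 𝔼 e, T Y e) := expect_sqrt_le fun Y => expect_nonneg fun e _ => hT0 Y e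
      _ = √(v * tailSum hK x Q) := by
          congr 1
          simp only [T, expect_sum_comm, ← mul_expect, hNsq]
          rw [← sum_tailIndices, mul_sum]
          exact sum_congr rfl fun q _ => by field_simp; rw [hlamb]; ring
  calc _ ≤ 𝔼 Y, 𝔼 e, ((∑ q ∈ Sᶜ, N Y e q ^ 2) / (4 * D) + M * √(T Y e)) :=
        expect_le_expect fun Y _ => expect_le_expect fun e _ => hpt Y e
    _ = (#Sᶜ * (v / n)) / (4 * D) + M * 𝔼 Y, 𝔼 e, √(T Y e) := by
        simp only [expect_add_distrib, ← mul_expect, ← expect_div, expect_sum_comm, hNsq,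
          sum_const, nsmul_eq_mul]
    _ ≤ (Q * (v / n)) / (4 * D) + M * √(v * tailSum hK x Q) := by
        have : (#Sᶜ : ℝ) ≤ Q := by exact_mod_cast card_compl_tailIndices_le n Q
        gcongr
    _ = _ := by field_simp

end Kernel

/-! ### Exponential moments of the penalized deviation -/

section Deviation

variable {X : Type*} {K : Matrix X X ℝ} {H : Type*} [NormedAddCommGroup H]
  [InnerProductSpace ℝ H] [CompleteSpace H] [RKHS ℝ H X ℝ] {ι : Type} [Finite ι] [Nonempty ι]

/-- The exponential moment of the penalized deviation for a sample drawn with replacement. -/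
theorem expect_exp_ciSup_sample_le {n : ℕ} [NeZero n] {x : Fin n → X} (hK : K.PosSemidef)
    (hH : IsRKHSOf H K) (g : ι → Fin n → ℝ) (w : ι → H) {L₀ M ω lam σ : ℝ} (hω : 0 < ω)
    (hlam : 0 ≤ lam) (hlamω : 32 * lam ≤ ω) (hlamL : 8 * lam * L₀ ≤ 1) (hσ : |σ| ≤ 2)
    (hg : ∀ i k, |g i k| ≤ L₀) (hw : ∀ i, ‖w i‖ ≤ M) (hgw : ∀ i k, |g i k| ≤ |w i (x k)|)
    (hlip : ∀ i j k, |g i k - g j k| ≤ |w i (x k) - w j (x k)|) {v : ℕ} (hv : 0 < v) (Q : ℕ) :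
    𝔼 Y : Fin v → Fin n, Real.exp (lam *
        ⨆ i, (σ * (∑ j, g i (Y j) - v * 𝔼 k, g i k) - v * ω * 𝔼 k, w i (x k) ^ 2)) ≤
      Real.exp (lam * (32 * Q / ω + 8 * M * √(v * tailSum hK x Q))) := by
  have hn : (n : ℝ) ≠ 0 := by exact_mod_cast NeZero.ne n
  have hv' : (0 : ℝ) < v := by exact_mod_cast hv
  have hL₀ : 0 ≤ L₀ := (abs_nonneg _).trans (hg (Classical.arbitrary ι) 0)
  -- the loss class after compensation by the squares
  let p : ι → Fin n → ℝ := fun i k => σ * g i k + 2 * lam * (σ * g i k) ^ 2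
  have hσ2 : σ ^ 2 ≤ 4 := by
    have := sq_le_sq' (by linarith [abs_nonneg σ]) hσ
    rw [sq_abs] at this; linarith
  have hsq : ∀ i, 𝔼 k, (σ * g i k) ^ 2 ≤ 4 * 𝔼 k, w i (x k) ^ 2 := fun i => by
    rw [mul_expect]
    refine expect_le_expect fun k _ => ?_
    rw [mul_pow]
    have := sq_le_sq.2 (hgw i k)
    nlinarith [sq_nonneg (w i (x k)), sq_nonneg (g i k)]
  have h1 := expect_exp_ciSup_sum_le hlam (b := 2 * L₀) (by nlinarith) v
    (fun i => -(v * (σ * 𝔼 k, g i k + ω * 𝔼 k, w i (x k) ^ 2))) (fun i k => σ * g i k)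
    (fun i k => (σ * g i k) ^ 2)
    (fun i k => by rw [abs_mul]; exact mul_le_mul hσ (hg i k) (abs_nonneg _) (by norm_num))
    (fun i k => le_rfl)
  -- one half of the penalty absorbs the means of the squares, the other half is kept
  have h2 : 𝔼 Y : Fin v → Fin n, ⨆ i, (-(v * (σ * 𝔼 k, g i k + ω * 𝔼 k, w i (x k) ^ 2)) +
      ∑ j, (σ * g i (Y j) + 2 * lam * ((σ * g i (Y j)) ^ 2 + 𝔼 k, (σ * g i k) ^ 2))) ≤
      𝔼 Y : Fin v → Fin n, ⨆ i, (∑ j, (p i (Y j) - 𝔼 k, p i k) -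
        2 * (v * ω / 4 * 𝔼 k, w i (x k) ^ 2)) := by
    refine expect_le_expect fun Y _ =>
      ciSup_mono (Set.finite_range _).bddAbove fun i => ?_
    have e1 : 𝔼 k, p i k = σ * 𝔼 k, g i k + 2 * lam * 𝔼 k, (σ * g i k) ^ 2 := by
      simp only [p, expect_add_distrib, mul_expect]
    simp only [e1, mul_add, sum_add_distrib, sum_sub_distrib, sum_const, card_univ,
      Fintype.card_fin, nsmul_eq_mul, p]
    have hT : 0 ≤ 𝔼 k, w i (x k) ^ 2 := expect_nonneg fun k _ => sq_nonneg _
    have h3 : 4 * lam * 𝔼 k, (σ * g i k) ^ 2 ≤ ω / 2 * 𝔼 k, w i (x k) ^ 2 := by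
      have := mul_le_mul_of_nonneg_left (hsq i) hlam
      nlinarith
    have h4 := mul_le_mul_of_nonneg_left h3 hv'.le
    linarith
  have h3 := expect_ciSup_symmetrization v p fun i => v * ω / 4 * 𝔼 k, w i (x k) ^ 2
  -- the map `z ↦ σ * z + 2 * lam * (σ * z) ^ 2` is `4`-Lipschitz on `[-L₀, L₀]`
  have h4 : ∀ Y : Fin v → Fin n, 𝔼 e : Fin v → Bool, ⨆ i, (-(v * ω / 4 * 𝔼 k, w i (x k) ^ 2) +
        ∑ j, boolSign (e j) * p i (Y j)) ≤
      𝔼 e : Fin v → Bool, ⨆ i, (-(v * ω / 4 * 𝔼 k, w i (x k) ^ 2) +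
        ∑ j, boolSign (e j) * ((4 : ℝ) • w i) (x (Y j))) := fun Y =>
    expect_ciSup_boolSign_contraction _ _ _ fun i k j => by
      have e1 : p i (Y j) - p k (Y j) = (g i (Y j) - g k (Y j)) *
          (σ * (1 + 2 * lam * (σ * (g i (Y j) + g k (Y j))))) := by
        simp only [p]; ring
      have e2 : ((4 : ℝ) • w i) (x (Y j)) - ((4 : ℝ) • w k) (x (Y j)) =
          (w i (x (Y j)) - w k (x (Y j))) * 4 := by
        simp; ring
      rw [e1, e2, abs_mul, abs_mul _ (4 : ℝ)]
      refine mul_le_mul (hlip i k _) ?_ (abs_nonneg _) (abs_nonneg _)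
      have e3 : |σ * (g i (Y j) + g k (Y j))| ≤ 2 * (2 * L₀) := by
        rw [abs_mul]
        refine mul_le_mul hσ ((abs_add_le _ _).trans ?_) (abs_nonneg _) (by norm_num)
        linarith [hg i (Y j), hg k (Y j)]
      have e4 : |1 + 2 * lam * (σ * (g i (Y j) + g k (Y j)))| ≤ 2 := by
        refine (abs_add_le _ _).trans ?_
        rw [abs_one, abs_mul, abs_of_nonneg (by positivity : 0 ≤ 2 * lam)]
        nlinarith
      rw [abs_mul, abs_of_pos (by norm_num : (0 : ℝ) < 4)]
      nlinarith [abs_nonneg σ, abs_nonneg (1 + 2 * lam * (σ * (g i (Y j) + g k (Y j))))]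
  -- `D` expresses the penalty on `w i` in terms of the sum of squares of `4 • w i`
  have h5 := expect_ciSup_boolSign_rkhs_le (x := x) hK hH (fun i => (4 : ℝ) • w i) (M := 4 * M)
    (D := v * ω / (64 * n)) (fun i => by
      rw [norm_smul]; simpa using hw i) (by
      have : (0 : ℝ) < n := by exact_mod_cast Nat.pos_of_ne_zero (NeZero.ne n)
      positivity) v Q
  have h6 : ∀ i, v * ω / (64 * n) * ∑ k, ((4 : ℝ) • w i) (x k) ^ 2 =
      v * ω / 4 * 𝔼 k, w i (x k) ^ 2 := fun i => by
    rw [Fintype.expect_eq_sum_div_card, Fintype.card_fin]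
    simp only [RKHS.coe_smul, Pi.smul_apply, smul_eq_mul, mul_pow, ← mul_sum]
    field_simp; norm_num
  simp only [h6] at h5
  refine le_trans (le_of_eq ?_) (h1.trans (Real.exp_le_exp.2 (mul_le_mul_of_nonneg_left
    (h2.trans (h3.trans ?_)) hlam)))
  · refine expect_congr rfl fun Y _ => ?_
    congr! 4 with i
    rw [← mul_sum]; ring
  · refine (mul_le_mul_of_nonneg_left
      ((expect_le_expect fun Y _ => h4 Y).trans h5) (by norm_num)).trans (le_of_eq ?_)
    field_simp; ring

/-- The exponential of a supremum of affine functions is convex. -/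
theorem convexOn_exp_ciSup {α : Type*} [Fintype α] (a : ι → ℝ) (g : ι → α → ℝ) {lam : ℝ}
    (hlam : 0 ≤ lam) :
    ConvexOn ℝ Set.univ fun N : α → ℝ => Real.exp (lam * ⨆ i, (a i + ∑ k, N k * g i k)) := by
  refine ⟨convex_univ, fun N _ N' _ s t hs ht hst => ?_⟩
  refine le_trans ?_ (convexOn_exp.2 (Set.mem_univ _) (Set.mem_univ _) hs ht hst)
  rw [Real.exp_le_exp]
  simp only [smul_eq_mul]
  have : ⨆ i, (a i + ∑ k, (s • N + t • N') k * g i k) ≤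
      s * (⨆ i, (a i + ∑ k, N k * g i k)) + t * ⨆ i, (a i + ∑ k, N' k * g i k) := by
    refine ciSup_le fun i => ?_
    have h1 := mul_le_mul_of_nonneg_left
      (le_ciSup_of_finite (fun i => a i + ∑ k, N k * g i k) i) hs
    have h2 := mul_le_mul_of_nonneg_left
      (le_ciSup_of_finite (fun i => a i + ∑ k, N' k * g i k) i) ht
    refine le_trans (le_of_eq ?_) (add_le_add h1 h2)
    have h3 : ∑ k, (s • N + t • N') k * g i k = s * ∑ k, N k * g i k + t * ∑ k, N' k * g i k := by
      rw [mul_sum, mul_sum, ← sum_add_distrib]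
      exact sum_congr rfl fun k _ => by simp; ring
    rw [h3]
    linear_combination -(a i) * hst
  nlinarith

end Deviation

/-! ### The difference of the test and training averages -/

theorem fullSqAvg_eq_expect {n : ℕ} (h : Fin n → ℝ) : fullSqAvg h = 𝔼 i, h i ^ 2 := by
  rw [fullSqAvg, Fintype.expect_eq_sum_div_card, Fintype.card_fin]; ring

section Sample

variable {m u : ℕ}

theorem sum_testSet_add_sum_trainSet (d : Draws m u) (h : Fin (m + u) → ℝ) :
    ∑ i ∈ testSet d, h i + ∑ i ∈ trainSet d, h i = (m + u) * 𝔼 i, h i := by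
  rw [trainSet, sum_add_sum_compl]
  have := Fintype.card_mul_expect h
  rw [Fintype.card_fin] at this
  rw [← this]; push_cast; ring

theorem fullAvg_eq (hm : 0 < m) (hu : 0 < u) (d : Draws m u) (h : Fin (m + u) → ℝ) :
    (m + u) * fullAvg h = u * testAvg d h + m * trainAvg d h := by
  have hm' : (m : ℝ) ≠ 0 := by positivity
  have hu' : (u : ℝ) ≠ 0 := by positivity
  have hn : (m : ℝ) + u ≠ 0 := by positivity
  rw [fullAvg, testAvg, trainAvg, trainSet, ← sum_add_sum_compl (testSet d)]
  push_cast
  field_simp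

theorem testAvg_sub (d : Draws m u) (h h' : Fin (m + u) → ℝ) :
    testAvg d (fun i => h i - h' i) = testAvg d h - testAvg d h' := by
  simp only [testAvg, sum_sub_distrib, mul_sub]

theorem trainAvg_sub (d : Draws m u) (h h' : Fin (m + u) → ℝ) :
    trainAvg d (fun i => h i - h' i) = trainAvg d h - trainAvg d h' := by
  simp only [trainAvg, sum_sub_distrib, mul_sub]

theorem fullAvg_sub {n : ℕ} (h h' : Fin n → ℝ) :
    fullAvg (fun i => h i - h' i) = fullAvg h - fullAvg h' := by
  simp only [fullAvg, sum_sub_distrib, mul_sub]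

theorem testDeviation_eq (hm : 0 < m) (hu : 0 < u) (d : Draws m u) (h : Fin (m + u) → ℝ) :
    u * (testAvg d h - trainAvg d h) =
      (m + u) / m * (∑ i ∈ testSet d, h i - u * 𝔼 i, h i) := by
  have hm' : (m : ℝ) ≠ 0 := by positivity
  have hu' : (u : ℝ) ≠ 0 := by positivity
  have := sum_testSet_add_sum_trainSet d h
  rw [testAvg, trainAvg, eq_sub_iff_add_eq'.2 this]
  field_simp; ring

theorem trainDeviation_eq (hm : 0 < m) (hu : 0 < u) (d : Draws m u) (h : Fin (m + u) → ℝ) :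
    m * (testAvg d h - trainAvg d h) =
      -((m + u) / u) * (∑ i ∈ trainSet d, h i - m * 𝔼 i, h i) := by
  have hm' : (m : ℝ) ≠ 0 := by positivity
  have hu' : (u : ℝ) ≠ 0 := by positivity
  have := sum_testSet_add_sum_trainSet d h
  rw [testAvg, trainAvg, eq_sub_iff_add_eq.2 this]
  field_simp; ring

end Sample

section Rate

variable {X : Type*} {K : Matrix X X ℝ} {m u : ℕ}

theorem rate_nonneg (hK : K.PosSemidef) (x : Fin (m + u) → X) (Q : ℕ) : 0 ≤ rate hK x Q := by
  unfold rate; positivity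

theorem exists_minRate_eq (hK : K.PosSemidef) (x : Fin (m + u) → X) :
    ∃ Q, minRate hK x = rate hK x Q := by
  obtain ⟨Q, -, hQ⟩ := exists_mem_eq_inf' (nonempty_range_add_one (n := m + u))
    fun Q => rate hK x Q
  exact ⟨Q, hQ⟩

theorem sqrt_tailSum_div_min_le_rate (hK : K.PosSemidef) (x : Fin (m + u) → X) (Q : ℕ) :
    √(tailSum hK x Q / (min m u : ℕ)) ≤ rate hK x Q := by
  unfold rate
  have h1 : (0 : ℝ) ≤ Q * (1 / (u : ℝ) + 1 / (m : ℝ)) := by positivity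
  have h2 := Real.sqrt_nonneg (tailSum hK x Q / u)
  have h3 := Real.sqrt_nonneg (tailSum hK x Q / m)
  rcases min_choice m u with h | h <;> rw [h] <;> linarith

theorem div_min_le_rate (hK : K.PosSemidef) (x : Fin (m + u) → X) (Q : ℕ) :
    (Q : ℝ) / (min m u : ℕ) ≤ rate hK x Q := by
  unfold rate
  have h1 : (0 : ℝ) ≤ Q / u := by positivity
  have h4 : (0 : ℝ) ≤ Q / m := by positivity
  have h2 := Real.sqrt_nonneg (tailSum hK x Q / u)
  have h3 := Real.sqrt_nonneg (tailSum hK x Q / m)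
  rw [mul_add, mul_one_div, mul_one_div]
  rcases min_choice m u with h | h <;> rw [h] <;> linarith

theorem complexity_le_rate (hm : 0 < m) (hu : 0 < u) (hK : K.PosSemidef) (x : Fin (m + u) → X)
    (Q : ℕ) {ω M : ℝ} (hω : 0 < ω) (hM : 0 ≤ M) :
    32 * Q / ω + 8 * M * √((min m u : ℕ) * tailSum hK x Q) ≤
      (min m u : ℕ) * ((32 / ω + 8 * M) * rate hK x Q) := by
  have hv : (0 : ℝ) < (min m u : ℕ) := by exact_mod_cast lt_min hm hu
  have h1 := div_min_le_rate hK x Q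
  have h2 := sqrt_tailSum_div_min_le_rate hK x Q
  generalize ((min m u : ℕ) : ℝ) = v at *
  rw [div_le_iff₀ hv] at h1
  have h3 : √(v * tailSum hK x Q) = v * √(tailSum hK x Q / v) := by
    rw [show v * tailSum hK x Q = v ^ 2 * (tailSum hK x Q / v) by field_simp,
      Real.sqrt_mul (sq_nonneg v), Real.sqrt_sq hv.le]
  rw [h3]
  calc 32 * Q / ω + 8 * M * (v * √(tailSum hK x Q / v))
      = 32 / ω * Q + 8 * M * (v * √(tailSum hK x Q / v)) := by ring
    _ ≤ 32 / ω * (rate hK x Q * v) + 8 * M * (v * rate hK x Q) := by gcongr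
    _ = _ := by ring

end Rate

/-! ### The uniform deviation bound -/

/-- For every pair of predictors in `F`, the test average of the difference of the losses exceeds
the training average by at most `b` plus `a` times the mean square distances to `fstar`. -/
def DeviationBound {X H : Type*} [FunLike H X ℝ] {m u : ℕ} (ℓ : ℝ → ℝ → ℝ)
    (x : Fin (m + u) → X) (y : Fin (m + u) → ℝ) (F : Set H) (fstar : H) (d : Draws m u)
    (a b : ℝ) : Prop :=
  ∀ f₁ ∈ F, ∀ f₂ ∈ F,
    testAvg d (fun i => lossOf ℓ x y f₁ i - lossOf ℓ x y f₂ i) ≤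
      trainAvg d (fun i => lossOf ℓ x y f₁ i - lossOf ℓ x y f₂ i) +
      a * (fullSqAvg (fun i => f₁ (x i) - fstar (x i)) +
        fullSqAvg (fun i => f₂ (x i) - fstar (x i))) + b

section Deviation

variable {X : Type*} {K : Matrix X X ℝ} {H : Type*} [NormedAddCommGroup H]
  [InnerProductSpace ℝ H] [CompleteSpace H] [RKHS ℝ H X ℝ] {m u : ℕ} {x : Fin (m + u) → X}

/-- The exponential moment of the penalized difference of the averages over the test and the
training set, in either direction. The difference is a multiple, by a factor at most two, of the
centred sum over the smaller of the two sets, which is a sample without replacement. -/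
theorem expect_exp_ciSup_deviation_le {ι : Type} [Finite ι] [Nonempty ι] (hm : 0 < m) (hu : 0 < u)
    (hK : K.PosSemidef) (hH : IsRKHSOf H K) (g : ι → Fin (m + u) → ℝ) (w : ι → H)
    {L₀ M ω lam τ : ℝ} (hω : 0 < ω)
    (hlam : 0 ≤ lam) (hlamω : 32 * lam ≤ ω) (hlamL : 8 * lam * L₀ ≤ 1) (hτ : |τ| ≤ 1)
    (hg : ∀ i k, |g i k| ≤ L₀) (hw : ∀ i, ‖w i‖ ≤ M) (hgw : ∀ i k, |g i k| ≤ |w i (x k)|)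
    (hlip : ∀ i j k, |g i k - g j k| ≤ |w i (x k) - w j (x k)|) (Q : ℕ) :
    𝔼 d : Draws m u, Real.exp (lam * ⨆ i, (min m u : ℕ) *
        (τ * (testAvg d (g i) - trainAvg d (g i)) - ω * 𝔼 k, w i (x k) ^ 2)) ≤
      Real.exp (lam * ((min m u : ℕ) * ((32 / ω + 8 * M) * rate hK x Q))) := by
  have : NeZero (m + u) := ⟨by omega⟩
  have hM : 0 ≤ M := (norm_nonneg _).trans (hw (Classical.arbitrary ι))
  have key : ∀ (v : ℕ) (_ : 0 < v) (σ : ℝ) (_ : |σ| ≤ 2) (T : Draws m u → Finset (Fin (m + u))),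
      (∀ F : (Fin (m + u) → ℝ) → ℝ, ConvexOn ℝ Set.univ F →
        𝔼 d : Draws m u, F (fun a => if a ∈ T d then 1 else 0) ≤
          𝔼 Y : Fin v → Fin (m + u), F (fun a => ∑ j, if Y j = a then 1 else 0)) →
      𝔼 d : Draws m u, Real.exp (lam * ⨆ i, (σ * (∑ k ∈ T d, g i k - v * 𝔼 k, g i k) -
          v * ω * 𝔼 k, w i (x k) ^ 2)) ≤
        Real.exp (lam * (32 * Q / ω + 8 * M * √(v * tailSum hK x Q))) := by
    intro v hv σ hσ T hT
    have h1 := hT _ (convexOn_exp_ciSup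
      (fun i => -(σ * (v * 𝔼 k, g i k) + v * ω * 𝔼 k, w i (x k) ^ 2))
      (fun i k => σ * g i k) hlam)
    have h2 := expect_exp_ciSup_sample_le (x := x) hK hH g w hω hlam hlamω hlamL hσ hg hw hgw
      hlip hv Q
    refine le_trans (le_of_eq ?_) (h1.trans (le_of_eq_of_le ?_ h2))
    · refine expect_congr rfl fun d _ => ?_
      congr! 4 with i
      simp only [ite_mul, one_mul, zero_mul, sum_ite_mem, univ_inter, ← mul_sum]
      ring
    · refine expect_congr rfl fun Y _ => ?_
      congr! 4 with i
      simp only [sum_mul, ite_mul, one_mul, zero_mul]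
      rw [sum_comm]
      simp only [sum_ite_eq, mem_univ, if_true, ← mul_sum]
      ring
  refine le_trans ?_ (Real.exp_le_exp.2
    (mul_le_mul_of_nonneg_left (complexity_le_rate hm hu hK x Q hω hM) hlam))
  have hm' : (0 : ℝ) < m := by positivity
  have hu' : (0 : ℝ) < u := by positivity
  rcases le_total u m with h | h
  · rw [min_eq_right h]
    have hum : (u : ℝ) ≤ m := by exact_mod_cast h
    refine le_trans (le_of_eq ?_) (key u hu (τ * ((m + u) / m)) ?_ testSet
      fun F hF => expect_testSet_le hF hu)
    · refine expect_congr rfl fun d _ => ?_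
      congr! 4 with i
      rw [mul_assoc τ, ← testDeviation_eq hm hu]; ring
    · rw [abs_mul, abs_of_pos (by positivity : (0 : ℝ) < (m + u) / m)]
      have : ((m : ℝ) + u) / m ≤ 2 := by rw [div_le_iff₀ hm']; linarith
      nlinarith [abs_nonneg τ]
  · rw [min_eq_left h]
    have hum : (m : ℝ) ≤ u := by exact_mod_cast h
    refine le_trans (le_of_eq ?_) (key m hm (τ * -((m + u) / u)) ?_ trainSet
      fun F hF => expect_trainSet_le hF hm)
    · refine expect_congr rfl fun d _ => ?_
      congr! 4 with i
      rw [mul_assoc τ, ← trainDeviation_eq hm hu]; ring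
    · rw [abs_mul, abs_neg, abs_of_pos (by positivity : (0 : ℝ) < (m + u) / u)]
      have : ((m : ℝ) + u) / u ≤ 2 := by rw [div_le_iff₀ hu']; linarith
      nlinarith [abs_nonneg τ]

/-- The scale of the exponential moments that both the penalty and the bound on the loss allow. -/
noncomputable def expScale (ω L₀ : ℝ) : ℝ :=
  min (ω / 32) (1 / (8 * L₀))

theorem expScale_pos {ω L₀ : ℝ} (hω : 0 < ω) (hL₀ : 0 < L₀) : 0 < expScale ω L₀ :=
  lt_min (by positivity) (by positivity)

/-- The uniform deviation inequality. Both directions of the deviation are controlled at once,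
because the exponential of a mean is at most the mean of the exponentials. -/
theorem one_sub_exp_neg_le_deviationBound (hm : 0 < m) (hu : 0 < u) (hK : K.PosSemidef)
    (hH : IsRKHSOf H K) {ℓ : ℝ → ℝ → ℝ} {y : Fin (m + u) → ℝ} {F : Set H} {fstar : H}
    {L L₀ μ ω : ℝ} (hω : 0 < ω) (hL₀ : 0 < L₀) (hstar : fstar ∈ F) (hF : ∀ f ∈ F, ‖f‖ ≤ μ)
    (hℓ : ∀ f ∈ F, ∀ i, 0 ≤ lossOf ℓ x y f i ∧ lossOf ℓ x y f i ≤ L₀)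
    (hlip : ∀ f ∈ F, ∀ g ∈ F, ∀ i,
      |lossOf ℓ x y f i - lossOf ℓ x y g i| ≤ L * |f (x i) - g (x i)|) (s : ℝ) :
    1 - Real.exp (-s) ≤ (drawLaw m u).real {d | DeviationBound ℓ x y F fstar d (ω * L ^ 2)
      (2 * (32 / ω + 16 * |L| * μ) * minRate hK x +
        2 / expScale ω L₀ * s / (min m u : ℕ))} := by
  obtain ⟨Q, hQ⟩ := exists_minRate_eq hK x
  set lam := expScale ω L₀ with hlam
  have hlam0 : 0 < lam := expScale_pos hω hL₀
  have hlamω : 32 * lam ≤ ω := by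
    have : lam ≤ ω / 32 := min_le_left _ _
    linarith
  have hlamL : 8 * lam * L₀ ≤ 1 := by
    have : lam ≤ 1 / (8 * L₀) := min_le_right _ _
    rw [le_div_iff₀ (by positivity)] at this
    linarith
  have hv : (0 : ℝ) < (min m u : ℕ) := by exact_mod_cast lt_min hm hu
  set S := {d | DeviationBound ℓ x y F fstar d (ω * L ^ 2)
      (2 * (32 / ω + 16 * |L| * μ) * minRate hK x +
        2 / lam * s / (min m u : ℕ))} with hS
  -- a finite family of pairs that witnesses every failure of the bound
  have hpair : ∀ d : Draws m u, ∃ f : H × H, f.1 ∈ F ∧ f.2 ∈ F ∧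
      (testAvg d (fun i => lossOf ℓ x y f.1 i - lossOf ℓ x y f.2 i) ≤
      trainAvg d (fun i => lossOf ℓ x y f.1 i - lossOf ℓ x y f.2 i) +
      ω * L ^ 2 * (fullSqAvg (fun i => f.1 (x i) - fstar (x i)) +
        fullSqAvg (fun i => f.2 (x i) - fstar (x i))) +
      (2 * (32 / ω + 16 * |L| * μ) * minRate hK x +
        2 / lam * s / (min m u : ℕ)) → d ∈ S) := by
    intro d
    by_cases hd : d ∈ S
    · exact ⟨(fstar, fstar), hstar, hstar, fun _ => hd⟩
    · rw [hS, Set.mem_ofPred_eq, DeviationBound] at hd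
      push Not at hd
      obtain ⟨f₁, h1, f₂, h2, h3⟩ := hd
      exact ⟨(f₁, f₂), h1, h2, fun h => absurd h (not_le.2 h3)⟩
  choose p hp1 hp2 hp3 using hpair
  -- by the Lipschitz condition the increments of the relative loss `g` are dominated by those of `w`
  let g : H → Fin (m + u) → ℝ := fun f i => lossOf ℓ x y f i - lossOf ℓ x y fstar i
  let w : H → H := fun f => |L| • (f - fstar)
  have hwx : ∀ f i, w f (x i) = |L| * (f (x i) - fstar (x i)) := fun f i => by simp [w]
  have hw : ∀ f ∈ F, ‖w f‖ ≤ 2 * |L| * μ := fun f hf => by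
    have h1 := (norm_sub_le f fstar).trans (add_le_add (hF f hf) (hF fstar hstar))
    have := mul_le_mul_of_nonneg_left h1 (abs_nonneg L)
    rw [norm_smul, Real.norm_eq_abs, abs_abs]
    linarith
  have hg0 : ∀ f ∈ F, ∀ i, |g f i| ≤ L₀ := fun f hf i => by
    have h1 := hℓ f hf i; have h2 := hℓ fstar hstar i
    rw [abs_le]; constructor <;> simp only [g] <;> linarith
  have hgl : ∀ f₁ ∈ F, ∀ f₂ ∈ F, ∀ i, |g f₁ i - g f₂ i| ≤ |w f₁ (x i) - w f₂ (x i)| := by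
    intro f₁ h1 f₂ h2 i
    have e1 : g f₁ i - g f₂ i = lossOf ℓ x y f₁ i - lossOf ℓ x y f₂ i := by simp only [g]; ring
    have e2 : w f₁ (x i) - w f₂ (x i) = |L| * (f₁ (x i) - f₂ (x i)) := by
      rw [hwx, hwx]; ring
    rw [e1, e2, abs_mul, abs_abs]
    exact (hlip f₁ h1 f₂ h2 i).trans (mul_le_mul_of_nonneg_right (le_abs_self L) (abs_nonneg _))
  have hgw : ∀ f ∈ F, ∀ i, |g f i| ≤ |w f (x i)| := fun f hf i => by
    have := hgl f hf fstar hstar i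
    simpa [g, w] using this
  have hT : ∀ f, 𝔼 k, w f (x k) ^ 2 = L ^ 2 * fullSqAvg (fun i => f (x i) - fstar (x i)) :=
    fun f => by
      simp only [hwx, mul_pow, sq_abs]
      rw [fullSqAvg_eq_expect, mul_expect]
  let Φ : ℝ → H → Draws m u → ℝ := fun τ f d => (min m u : ℕ) *
    (τ * (testAvg d (g f) - trainAvg d (g f)) - ω * 𝔼 k, w f (x k) ^ 2)
  have hexp : ∀ (τ : ℝ) (q : Draws m u → H), |τ| ≤ 1 → (∀ d, q d ∈ F) →
      𝔼 d, Real.exp (lam * ⨆ i, Φ τ (q i) d) ≤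
      Real.exp (lam * ((min m u : ℕ) * ((32 / ω + 16 * |L| * μ) * minRate hK x))) := by
    intro τ q hτ hq
    have := expect_exp_ciSup_deviation_le hm hu hK hH (fun i => g (q i)) (fun i => w (q i)) hω
      hlam0.le hlamω hlamL hτ (fun i => hg0 _ (hq i)) (fun i => hw _ (hq i))
      (fun i => hgw _ (hq i)) (fun i j => hgl _ (hq i) _ (hq j)) Q
    rw [hQ]
    convert this using 6
    ring
  have h1 := hexp 1 (fun d => (p d).1) (by simp) hp1
  have h2 := hexp (-1) (fun d => (p d).2) (by simp) hp2
  refine one_sub_exp_neg_le_drawLaw (Z := fun d =>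
      1 / 2 * (lam * ⨆ i, Φ 1 (p i).1 d) + 1 / 2 * (lam * ⨆ i, Φ (-1) (p i).2 d))
    (r := lam * ((min m u : ℕ) * ((32 / ω + 16 * |L| * μ) * minRate hK x))) ?_ s ?_
  · calc _ ≤ 𝔼 d, (1 / 2 * Real.exp (lam * ⨆ i, Φ 1 (p i).1 d) +
          1 / 2 * Real.exp (lam * ⨆ i, Φ (-1) (p i).2 d)) :=
          expect_le_expect fun d _ => convexOn_exp.2 (Set.mem_univ _) (Set.mem_univ _)
            (by norm_num) (by norm_num) (by norm_num)
      _ ≤ _ := by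
          rw [expect_add_distrib, ← mul_expect, ← mul_expect]
          linarith
  · intro d hd
    refine hp3 d ?_
    have h3 := le_ciSup_of_finite (fun i => Φ 1 (p i).1 d) d
    have h4 := le_ciSup_of_finite (fun i => Φ (-1) (p i).2 d) d
    have h5 : lam * (Φ 1 (p d).1 d + Φ (-1) (p d).2 d) ≤
        2 * (lam * ((min m u : ℕ) * ((32 / ω + 16 * |L| * μ) * minRate hK x)) + s) := by
      have := mul_le_mul_of_nonneg_left (add_le_add h3 h4) hlam0.le
      linarith
    have e1 : testAvg d (g (p d).1) - trainAvg d (g (p d).1) -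
        (testAvg d (g (p d).2) - trainAvg d (g (p d).2)) =
        testAvg d (fun i => lossOf ℓ x y (p d).1 i - lossOf ℓ x y (p d).2 i) -
        trainAvg d (fun i => lossOf ℓ x y (p d).1 i - lossOf ℓ x y (p d).2 i) := by
      simp only [g, testAvg_sub, trainAvg_sub]; ring
    simp only [Φ, hT] at h5
    generalize ((min m u : ℕ) : ℝ) = v at *
    have h6 : lam * v * (testAvg d (fun i => lossOf ℓ x y (p d).1 i - lossOf ℓ x y (p d).2 i) -
        trainAvg d (fun i => lossOf ℓ x y (p d).1 i - lossOf ℓ x y (p d).2 i) -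
        ω * L ^ 2 * (fullSqAvg (fun i => (p d).1 (x i) - fstar (x i)) +
        fullSqAvg (fun i => (p d).2 (x i) - fstar (x i)))) ≤
        lam * v * (2 * (32 / ω + 16 * |L| * μ) * minRate hK x + 2 / lam * s / v) := by
      rw [← e1]
      have e2 : lam * v * (2 * (32 / ω + 16 * |L| * μ) * minRate hK x + 2 / lam * s / v) =
        2 * (lam * (v * ((32 / ω + 16 * |L| * μ) * minRate hK x)) + s) := by
        field_simp
      rw [e2]
      refine le_trans (le_of_eq ?_) h5
      ring
    have h7 := le_of_mul_le_mul_left h6 (mul_pos hlam0 hv)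
    linarith

end Deviation

/-! ### From the uniform deviation bound to the excess risk -/

section ExcessRisk

variable {X H : Type*} [FunLike H X ℝ] {m u : ℕ} {x : Fin (m + u) → X} {ℓ : ℝ → ℝ → ℝ}
  {y : Fin (m + u) → ℝ} {F : Set H} {fstar fm fu : H} {d : Draws m u} {a b : ℝ}

theorem DeviationBound.mono (h : DeviationBound ℓ x y F fstar d a b) {b' : ℝ} (hb : b ≤ b') :
    DeviationBound ℓ x y F fstar d a b' := fun f₁ h1 f₂ h2 =>
  (h f₁ h1 f₂ h2).trans (by linarith)

theorem DeviationBound.testAvg_le (h : DeviationBound ℓ x y F fstar d a b) (ha : 0 ≤ a) {B' : ℝ}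
    (hvar : ∀ f ∈ F, fullSqAvg (fun i => f (x i) - fstar (x i)) ≤
      B' * fullAvg (fun i => lossOf ℓ x y f i - lossOf ℓ x y fstar i))
    {f₁ f₂ : H} (h1 : f₁ ∈ F) (h2 : f₂ ∈ F) :
    testAvg d (fun i => lossOf ℓ x y f₁ i - lossOf ℓ x y f₂ i) ≤
      trainAvg d (fun i => lossOf ℓ x y f₁ i - lossOf ℓ x y f₂ i) +
      a * B' * (fullAvg (fun i => lossOf ℓ x y f₁ i - lossOf ℓ x y fstar i) +
        fullAvg (fun i => lossOf ℓ x y f₂ i - lossOf ℓ x y fstar i)) + b := by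
  have h3 := h f₁ h1 f₂ h2
  have h4 := mul_le_mul_of_nonneg_left (add_le_add (hvar f₁ h1) (hvar f₂ h2)) ha
  linarith

/-- The minimizers of the training and of the test loss exchange the roles of the two averages, so
the deviation bound controls the excess risk up to the penalty. -/
theorem DeviationBound.excessRisk_le (h : DeviationBound ℓ x y F fstar d a b)
    (hfm : IsTrainMinimizer ℓ x y F d fm) (hfu : IsTestMinimizer ℓ x y F d fu) :
    excessRisk ℓ x y d fm fu ≤ a * (fullSqAvg (fun i => fm (x i) - fstar (x i)) +
        fullSqAvg (fun i => fu (x i) - fstar (x i))) + b := by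
  have h1 := h fm hfm.1 fu hfu.1
  rw [testAvg_sub, trainAvg_sub] at h1
  have h2 := hfm.2 fu hfu.1
  rw [excessRisk]
  linarith

/-- With a small penalty the deviation bound, applied to the pairs `(fm, fstar)` and `(fstar, fu)`,
localizes both minimizers: their mean losses on the full sample exceed the least one by `O(b)`. -/
theorem DeviationBound.excessRisk_le_two_mul (h : DeviationBound ℓ x y F fstar d a b)
    (hm : 0 < m) (hu : 0 < u) (ha : 0 ≤ a) (hb : 0 ≤ b) {B' : ℝ} (haB : a * B' ≤ 1 / 4)
    (hstar : IsFullMinimizer ℓ x y F fstar)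
    (hvar : ∀ f ∈ F, fullSqAvg (fun i => f (x i) - fstar (x i)) ≤
      B' * fullAvg (fun i => lossOf ℓ x y f i - lossOf ℓ x y fstar i))
    (hfm : IsTrainMinimizer ℓ x y F d fm) (hfu : IsTestMinimizer ℓ x y F d fu) :
    excessRisk ℓ x y d fm fu ≤ 2 * b := by
  have hm' : (0 : ℝ) < m := by exact_mod_cast hm
  have hu' : (0 : ℝ) < u := by exact_mod_cast hu
  have hpos : ∀ f ∈ F, 0 ≤ fullAvg (fun i => lossOf ℓ x y f i - lossOf ℓ x y fstar i) :=
    fun f hf => by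
      rw [fullAvg_sub]; linarith [hstar.2 f hf]
  have hpen : ∀ f ∈ F, a * fullSqAvg (fun i => f (x i) - fstar (x i)) ≤
      1 / 4 * fullAvg (fun i => lossOf ℓ x y f i - lossOf ℓ x y fstar i) := fun f hf => by
    have h1 := mul_le_mul_of_nonneg_left (hvar f hf) ha
    have h2 := mul_le_mul_of_nonneg_right haB (hpos f hf)
    linarith
  have h0 : fullSqAvg (fun i => fstar (x i) - fstar (x i)) = 0 := by simp [fullSqAvg]
  have hloc_m : fullAvg (fun i => lossOf ℓ x y fm i - lossOf ℓ x y fstar i) ≤ 2 * b := by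
    have h1 := h fm hfm.1 fstar hstar.1
    rw [h0, add_zero] at h1
    have h2 := hpen fm hfm.1
    have h3 := hpos fm hfm.1
    have h4 := hfm.2 fstar hstar.1
    have h5 := fullAvg_eq hm hu d fun i => lossOf ℓ x y fm i - lossOf ℓ x y fstar i
    have h6 : trainAvg d (fun i => lossOf ℓ x y fm i - lossOf ℓ x y fstar i) ≤ 0 := by
      rw [trainAvg_sub]; linarith
    generalize fullAvg (fun i => lossOf ℓ x y fm i - lossOf ℓ x y fstar i) = z at *
    generalize testAvg d (fun i => lossOf ℓ x y fm i - lossOf ℓ x y fstar i) = t at *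
    generalize trainAvg d (fun i => lossOf ℓ x y fm i - lossOf ℓ x y fstar i) = r at *
    have h7 : t ≤ r + (1 / 4 * z + b) := by linarith
    by_contra hlt
    push Not at hlt
    nlinarith
  have hloc_u : fullAvg (fun i => lossOf ℓ x y fu i - lossOf ℓ x y fstar i) ≤ 2 * b := by
    have h1 := h fstar hstar.1 fu hfu.1
    rw [h0, zero_add, testAvg_sub, trainAvg_sub] at h1
    have h2 := hpen fu hfu.1
    have h3 := hpos fu hfu.1
    have h4 := hfu.2 fstar hstar.1
    have h5 := fullAvg_eq hm hu d fun i => lossOf ℓ x y fu i - lossOf ℓ x y fstar i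
    rw [testAvg_sub, trainAvg_sub] at h5
    generalize fullAvg (fun i => lossOf ℓ x y fu i - lossOf ℓ x y fstar i) = z at *
    generalize htt : testAvg d (lossOf ℓ x y fu) - testAvg d (lossOf ℓ x y fstar) = t at *
    generalize hrr : trainAvg d (lossOf ℓ x y fu) - trainAvg d (lossOf ℓ x y fstar) = r at *
    have h6 : t ≤ 0 := by linarith
    have h7 : r ≤ t + (1 / 4 * z + b) := by linarith
    by_contra hlt
    push Not at hlt
    nlinarith
  have h1 := h.excessRisk_le hfm hfu
  have h2 := hpen fm hfm.1
  have h3 := hpen fu hfu.1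
  linarith

end ExcessRisk

section SmallKernel

variable {X : Type*} {K : Matrix X X ℝ} {m u : ℕ} {x : Fin (m + u) → X}

theorem fullSqAvg_sub_le {H : Type*} [NormedAddCommGroup H] [InnerProductSpace ℝ H]
    [CompleteSpace H] [RKHS ℝ H X ℝ] (hK : K.PosSemidef) (hH : IsRKHSOf H K) {μ : ℝ} {f g : H}
    (hf : ‖f‖ ≤ μ) (hg : ‖g‖ ≤ μ) :
    fullSqAvg (fun i => f (x i) - g (x i)) ≤ 4 * μ ^ 2 * tailSum hK x 0 := by
  have hfg : ‖f - g‖ ^ 2 ≤ 4 * μ ^ 2 := by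
    have h1 := (norm_sub_le f g).trans (add_le_add hf hg)
    calc ‖f - g‖ ^ 2 ≤ (μ + μ) ^ 2 := by gcongr
      _ = _ := by ring
  rw [tailSum_zero, fullSqAvg, mul_left_comm, mul_sum _ _ (4 * μ ^ 2)]
  refine mul_le_mul_of_nonneg_left (sum_le_sum fun i _ => ?_) (by positivity)
  have h1 := sq_apply_le hH (f - g) (x i)
  rw [RKHS.coe_sub, Pi.sub_apply] at h1
  exact h1.trans (mul_le_mul_of_nonneg_right hfg hK.diag_nonneg)

/-- Either the rate is at least of the order of the inverse sample size, or the kernel is so small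
on the sample that its trace is below the rate. -/
theorem inv_min_le_minRate_or_tailSum_le (hm : 0 < m) (hu : 0 < u) (hK : K.PosSemidef)
    (x : Fin (m + u) → X) :
    1 / ((min m u : ℕ) : ℝ) ≤ minRate hK x ∨ tailSum hK x 0 ≤ minRate hK x := by
  obtain ⟨Q, hQ⟩ := exists_minRate_eq hK x
  have hv : (0 : ℝ) < (min m u : ℕ) := by exact_mod_cast lt_min hm hu
  rw [hQ]
  rcases Nat.eq_zero_or_pos Q with rfl | hpos
  · have h1 := sqrt_tailSum_div_min_le_rate hK x 0
    have h0 := tailSum_nonneg hK x 0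
    generalize ((min m u : ℕ) : ℝ) = v at *
    rcases le_total (1 / v) (tailSum hK x 0) with h | h
    · left
      refine le_trans (Real.le_sqrt_of_sq_le ?_) h1
      rw [sq, div_eq_mul_one_div (tailSum hK x 0) v]
      gcongr
    · right
      refine le_trans (Real.le_sqrt_of_sq_le ?_) h1
      rw [sq, div_eq_mul_one_div]
      gcongr
  · left
    refine le_trans ?_ (div_min_le_rate hK x Q)
    have : (1 : ℝ) ≤ Q := by exact_mod_cast hpos
    gcongr

theorem drawLaw_real_inter_ge (S T : Set (Draws m u)) {s : ℝ}
    (hS : 1 - Real.exp (-(s + Real.log 2)) ≤ (drawLaw m u).real S)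
    (hT : 1 - Real.exp (-(s + Real.log 2)) ≤ (drawLaw m u).real T) :
    1 - Real.exp (-s) ≤ (drawLaw m u).real (S ∩ T) := by
  have h1 := measureReal_union_add_inter (μ := drawLaw m u) (s := S) (Set.toFinite T).measurableSet
  have h2 : (drawLaw m u).real (S ∪ T) ≤ 1 := measureReal_le_one
  have h3 : Real.exp (-(s + Real.log 2)) = Real.exp (-s) / 2 := by
    rw [neg_add, ← sub_eq_add_neg, Real.exp_sub, Real.exp_log two_pos]
  linarith

end SmallKernel

end TransductiveKernel

theorem mainTheorem4 (A L₀ : ℝ) (hA : 1 < A) (hL₀ : 2 * Real.sqrt 2 ≤ L₀) :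
    ∃ c₁ : ℝ, 0 < c₁ ∧
    ∀ L B' μ : ℝ, 0 < μ →
    ∃ c₃ c₅ : ℝ, 0 < c₃ ∧ 0 < c₅ ∧
    ∀ (dim : ℕ) (𝒳 : Set (EuclideanSpace ℝ (Fin dim))) (𝒴 : Set ℝ)
      (K : Matrix 𝒳 𝒳 ℝ) (hK : K.PosSemidef)
      (H : Type*) [NormedAddCommGroup H] [InnerProductSpace ℝ H] [CompleteSpace H]
      [RKHS ℝ H 𝒳 ℝ] (_ : IsRKHSOf H K)
      (ℓ : ℝ → ℝ → ℝ) (m u : ℕ) (_ : 0 < m) (_ : 0 < u)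
      (x : Fin (m + u) → 𝒳) (y : Fin (m + u) → ℝ) (_ : ∀ i, y i ∈ 𝒴)
      -- the loss takes values in `[0, L₀]` on the sample
      (_ : ∀ f ∈ sampleBall H x μ, ∀ i, 0 ≤ lossOf ℓ x y f i ∧ lossOf ℓ x y f i ≤ L₀)
      -- the loss is `L`-Lipschitz in its first argument on the values of the predictors
      (_ : ∀ f ∈ sampleBall H x μ, ∀ g ∈ sampleBall H x μ, ∀ a b : 𝒳, ∀ t ∈ 𝒴,
        |ℓ (f a) t - ℓ (g b) t| ≤ L * |f a - g b|)
      (fstar : H) (_ : IsFullMinimizer ℓ x y (sampleBall H x μ) fstar)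
      -- the variance condition
      (_ : ∀ f ∈ sampleBall H x μ,
        fullSqAvg (fun i => f (x i) - fstar (x i)) ≤
          B' * fullAvg (fun i => lossOf ℓ x y f i - lossOf ℓ x y fstar i))
      (fm fu : Draws m u → H)
      (_ : ∀ d, IsTrainMinimizer ℓ x y (sampleBall H x μ) d (fm d))
      (_ : ∀ d, IsTestMinimizer ℓ x y (sampleBall H x μ) d (fu d))
      (s : ℝ) (_ : 0 < s),
      1 - Real.exp (-s) ≤ (drawLaw m u).real {d |
        (∀ f₁ ∈ sampleBall H x μ, ∀ f₂ ∈ sampleBall H x μ,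
          testAvg d (fun i => lossOf ℓ x y f₁ i - lossOf ℓ x y f₂ i) ≤
            trainAvg d (fun i => lossOf ℓ x y f₁ i - lossOf ℓ x y f₂ i) +
            2 * L ^ 2 * B' / A *
              (fullAvg (fun i => lossOf ℓ x y f₁ i - lossOf ℓ x y fstar i) +
                fullAvg (fun i => lossOf ℓ x y f₂ i - lossOf ℓ x y fstar i)) +
            c₃ * minRate hK x + c₁ * s / (min m u : ℕ)) ∧
        excessRisk ℓ x y d (fm d) (fu d) ≤
          c₅ * (minRate hK x + s / (min m u : ℕ))} := by
  have hL₀' : 0 < L₀ := lt_of_lt_of_le (by positivity) hL₀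
  have hω₁ : 0 < 2 / A := by positivity
  set c₁ := 2 / expScale (2 / A) L₀
  have hc₁0 : 0 < c₁ := div_pos two_pos (expScale_pos hω₁ hL₀')
  refine ⟨c₁, hc₁0, fun L B' μ hμ => ?_⟩
  -- the penalty `ω₂` is so small that the variance condition turns it into a quarter of the risk
  set ω₂ := 1 / (4 * (L ^ 2 * |B'| + 1)) with hω₂def
  have hω₂ : 0 < ω₂ := by positivity
  set c₂ := 2 / expScale ω₂ L₀
  have hc₂0 : 0 < c₂ := div_pos two_pos (expScale_pos hω₂ hL₀')
  set C₁ := 2 * (32 / (2 / A) + 16 * |L| * μ)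
  set C₂ := 2 * (32 / ω₂ + 16 * |L| * μ)
  have hC₁0 : 0 < C₁ := by positivity
  have hC₂0 : 0 < C₂ := by positivity
  have hlog : 0 < Real.log 2 := Real.log_pos one_lt_two
  refine ⟨C₁ + c₁ * Real.log 2,
    2 * (C₂ + c₂ * Real.log 2) + 2 * c₂ + (8 * (2 / A * L ^ 2) * μ ^ 2 + C₁) + c₁,
    by positivity, by positivity, ?_⟩
  intro dim 𝒳 𝒴 K hK H _ _ _ _ hH ℓ m u hm hu x y hy hℓ hlip fstar hstar hvar fm fu hfm hfu s hs
  have hv : (0 : ℝ) < (min m u : ℕ) := by exact_mod_cast lt_min hm hu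
  have hR0 : 0 ≤ minRate hK x := by
    obtain ⟨Q, hQ⟩ := exists_minRate_eq hK x
    rw [hQ]; exact rate_nonneg hK x Q
  have hball : ∀ f ∈ sampleBall H x μ, ‖f‖ ≤ μ := fun f hf => hf.1
  have hlip' : ∀ f ∈ sampleBall H x μ, ∀ g ∈ sampleBall H x μ, ∀ i,
      |lossOf ℓ x y f i - lossOf ℓ x y g i| ≤ L * |f (x i) - g (x i)| := fun f hf g hg i =>
    hlip f hf g hg (x i) (x i) (y i) (hy i)
  have hdev := fun {ω : ℝ} (hω : 0 < ω) => one_sub_exp_neg_le_deviationBound hm hu hK hH hω hL₀'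
    hstar.1 hball hℓ hlip'
  have hfirst : ∀ d b, DeviationBound ℓ x y (sampleBall H x μ) fstar d (2 / A * L ^ 2) b →
      ∀ f₁ ∈ sampleBall H x μ, ∀ f₂ ∈ sampleBall H x μ,
        testAvg d (fun i => lossOf ℓ x y f₁ i - lossOf ℓ x y f₂ i) ≤
          trainAvg d (fun i => lossOf ℓ x y f₁ i - lossOf ℓ x y f₂ i) +
          2 * L ^ 2 * B' / A *
            (fullAvg (fun i => lossOf ℓ x y f₁ i - lossOf ℓ x y fstar i) +
              fullAvg (fun i => lossOf ℓ x y f₂ i - lossOf ℓ x y fstar i)) + b := by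
    intro d b h f₁ h1 f₂ h2
    have h3 := h.testAvg_le (by positivity) hvar h1 h2
    rwa [show 2 / A * L ^ 2 * B' = 2 * L ^ 2 * B' / A by ring] at h3
  rcases inv_min_le_minRate_or_tailSum_le hm hu hK x with hcase | hcase
  · -- the rate absorbs the `log 2` that a union bound over two events costs
    have hlogv : Real.log 2 / (min m u : ℕ) ≤ Real.log 2 * minRate hK x := by
      rw [div_eq_mul_one_div]; gcongr
    refine (drawLaw_real_inter_ge _ _ (hdev hω₁ (s + Real.log 2))
      (hdev hω₂ (s + Real.log 2))).trans (measureReal_mono ?_)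
    rintro d ⟨h1, h2⟩
    replace h1 : DeviationBound ℓ x y (sampleBall H x μ) fstar d (2 / A * L ^ 2)
      (C₁ * minRate hK x + c₁ * (s + Real.log 2) / (min m u : ℕ)) := h1
    replace h2 : DeviationBound ℓ x y (sampleBall H x μ) fstar d (ω₂ * L ^ 2)
      (C₂ * minRate hK x + c₂ * (s + Real.log 2) / (min m u : ℕ)) := h2
    have hsplit : ∀ C c : ℝ, 0 ≤ c → C * minRate hK x + c * (s + Real.log 2) / (min m u : ℕ) ≤
        (C + c * Real.log 2) * minRate hK x + c * s / (min m u : ℕ) := fun C c hc => by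
      have := mul_le_mul_of_nonneg_left hlogv hc
      rw [mul_add, add_div, mul_div_assoc c (Real.log 2)]
      linarith
    constructor
    · intro f₁ hf₁ f₂ hf₂
      have h3 := hfirst d _ (h1.mono (hsplit _ _ hc₁0.le)) f₁ hf₁ f₂ hf₂
      linarith
    · have hB : ω₂ * L ^ 2 * B' ≤ 1 / 4 := by
        have h4 : L ^ 2 * B' ≤ L ^ 2 * |B'| + 1 := by
          have := mul_le_mul_of_nonneg_left (le_abs_self B') (sq_nonneg L)
          linarith
        have h5 : 0 < L ^ 2 * |B'| + 1 := by positivity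
        rw [hω₂def, mul_assoc, one_div_mul_eq_div, div_le_iff₀ (by positivity)]
        linarith
      have hb : 0 ≤ (C₂ + c₂ * Real.log 2) * minRate hK x + c₂ * s / (min m u : ℕ) := by
        positivity
      have h3 := (h2.mono (hsplit _ _ hc₂0.le)).excessRisk_le_two_mul hm hu (by positivity) hb hB
        hstar hvar (hfm d) (hfu d)
      have h4 : 0 ≤ s / (min m u : ℕ) := by positivity
      refine h3.trans ?_
      rw [mul_div_assoc]
      generalize s / ((min m u : ℕ) : ℝ) = z at h4 ⊢
      have e1 : 0 ≤ (8 * (2 / A * L ^ 2) * μ ^ 2 + C₁ + c₁) * (minRate hK x + z) := by positivity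
      have e2 : 0 ≤ 2 * (C₂ + c₂ * Real.log 2) * z := by positivity
      have e3 : 0 ≤ 2 * c₂ * minRate hK x := by positivity
      linarith
  · -- the penalty itself is below the rate, so a single event suffices
    refine (hdev hω₁ s).trans (measureReal_mono ?_)
    intro d h1
    replace h1 : DeviationBound ℓ x y (sampleBall H x μ) fstar d (2 / A * L ^ 2)
      (C₁ * minRate hK x + c₁ * s / (min m u : ℕ)) := h1
    constructor
    · intro f₁ hf₁ f₂ hf₂
      have h3 := hfirst d _ h1 f₁ hf₁ f₂ hf₂
      have e1 : 0 ≤ c₁ * Real.log 2 * minRate hK x := by positivity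
      linarith
    · have h3 := h1.excessRisk_le (hfm d) (hfu d)
      have hsq : ∀ f ∈ sampleBall H x μ, fullSqAvg (fun i => f (x i) - fstar (x i)) ≤
          4 * μ ^ 2 * minRate hK x := fun f hf =>
        (fullSqAvg_sub_le hK hH hf.1 hstar.1.1).trans
          (mul_le_mul_of_nonneg_left hcase (by positivity))
      have h5 := mul_le_mul_of_nonneg_left
        (add_le_add (hsq _ (hfm d).1) (hsq _ (hfu d).1)) (by positivity : 0 ≤ 2 / A * L ^ 2)
      have h4 : 0 ≤ s / (min m u : ℕ) := by positivity
      rw [mul_div_assoc] at h3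
      generalize s / ((min m u : ℕ) : ℝ) = z at h3 h4 ⊢
      have e1 : 0 ≤ (2 * (C₂ + c₂ * Real.log 2) + 2 * c₂) * (minRate hK x + z) := by positivity
      have e2 : 0 ≤ (8 * (2 / A * L ^ 2) * μ ^ 2 + C₁) * z := by positivity
      have e3 : 0 ≤ c₁ * minRate hK x := by positivity
      linarith
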